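/- Let $\beta>1$ be a real number and let $T_\beta(x)=\beta x \bmod 1$ on $[0,1)$. For $x\in[0,1)$ let $r_\beta(x)\in[0,+\infty]$ be the supremum of the real numbers $r\ge 0$ such that $|T_\beta^n x-x|<(\beta^n)^{-r}$ for infinitely many integers $n\ge 1$, and let $\widehat r_\beta(x)\in[0,+\infty]$ be the supremum of the real numbers $s\ge 0$ such that, for every sufficiently large integer $N$, there is an integer $n$ with $1\le n\le N$ and $|T_\beta^n x-x|<(\beta^N)^{-s}$. Then the set of $x\in[0,1)$ such that $$\widehat r_\beta(x)>\frac{r_\beta(x)}{1+r_\beta(x)}$$ (where the right-hand side is read as $1$ if $r_\beta(x)=+\infty$) has Hausdorff dimension $0$. Moreover, for every real number $\widehat r\in[0,1]$, $$\dim\{x\in[0,1):\widehat r_\beta(x)\ge\widehat r\}=\dim\{x\in[0,1):\widehat r_\beta(x)=\widehat r\}=\left(\frac{1-\widehat r}{1+\widehat r}\right)^2,$$ where $\dim$ denotes the Hausdorff dimension. -/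

import Mathlib

open Filter MeasureTheory
open scoped ENNReal Topology

noncomputable section

/-- The `β`-transformation `x ↦ βx mod 1`. -/
def betaMap (β x : ℝ) : ℝ := Int.fract (β * x)

/-- The exponent `r_β(x) ∈ [0, +∞]`: the supremum of the reals `r ≥ 0` such that
`|T_β^n x - x| < (β^n)^(-r)` for infinitely many integers `n ≥ 1`. -/
def recExp (β x : ℝ) : ℝ≥0∞ :=
  sSup (ENNReal.ofReal '' {r : ℝ | 0 ≤ r ∧
    {n : ℕ | 1 ≤ n ∧ |(betaMap β)^[n] x - x| < (β ^ n) ^ (-r)}.Infinite})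

/-- The uniform exponent `r̂_β(x) ∈ [0, +∞]`: the supremum of the reals `s ≥ 0` such that for every
sufficiently large integer `N` there is `1 ≤ n ≤ N` with `|T_β^n x - x| < (β^N)^(-s)`. -/
def uniformRecExp (β x : ℝ) : ℝ≥0∞ :=
  sSup (ENNReal.ofReal '' {s : ℝ | 0 ≤ s ∧
    ∀ᶠ N : ℕ in atTop, ∃ n : ℕ, 1 ≤ n ∧ n ≤ N ∧
      |(betaMap β)^[n] x - x| < (β ^ N) ^ (-s)})

/-- The quantity `r / (1 + r)` for `r ∈ [0, +∞]`, with its limit value `1` at `r = +∞`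
(the bare `ℝ≥0∞` quotient would be the junk value `0` there). -/
def ratioOneAdd (r : ℝ≥0∞) : ℝ≥0∞ := if r = ⊤ then 1 else r / (1 + r)

end

/-! ### Branches of the iterates of the `β`-transformation -/

/-! Cylinders are handled through their labels `β ^ n * x - T^n x`. Full cylinders can be
concatenated freely and have labels at mutual distance at least 1, while a non-full cylinder is the
last child of its parent. Hence an interval of length ℓ meets O(β^n ℓ + n) cylinders of order n, and
an interval of length at least a polynomial in j times β^(-j) contains a full cylinder of order j.

Upper bounds. If x is not periodic and its uniform exponent exceeds h, the record near-returns can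
be thinned to times n_k with |T^(n_k) x - x| ≤ β^(-h n_{k+1}) and geometric growth over two steps
(`exists_nearReturn_times`). On one cylinder of order n_k such points lie within O(β^(-(n_k + h
n_{k+1}))) of each other, so passing to order n_{k+1} multiplies the number of cylinders by about
β^(max((1-h) n_{k+1} - n_k, 0)). With F_k the sum of these exponents (`freeDigits`), about β^(F_k)
pieces of size β^(-(n_k + h n_{k+1})) suffice. Only exp(O(log² N)) sequences of times end at N, so
the dimension is at most θ as soon as F_k ≤ θ (n_k + h n_{k+1}) infinitely often
(`dimH_nearReturn_le`). For θ > ((1-h)/(1+h))² this must happen: otherwise F_k / n_k would decrease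
by a fixed amount every two steps, by an inequality that rests on a perfect square
(`freeDigits_succ_mul_le`). If the uniform exponent exceeds r/(1+r) with r finite, then (1-h)
n_{k+1} ≤ n_k eventually for a suitable h, so F_k is bounded and every θ > 0 is allowed. If r is
infinite, the uniform exponent exceeds 1 and the general bound at 1 is 0.

Lower bound. The square vanishes for n_{k+1} / n_k = 2/(1-s). With times in this ratio, nested full
cylinders are built: after n_k digits comes a block forcing the near-return, then about n_k free
digits. Reading the free choices as mixed radix digits of t ∈ [0,1) gives points x(t) with uniform
exponent at least s, and t is a σ-Hölder function of x(t) for each σ < ((1-s)/(1+s))². The points of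
exponent greater than s lie in countably many sets of smaller dimension, whose parameters form a
Lebesgue null set; the remaining parameters have dimension 1 and give the level set its dimension
(`le_dimH_of_inverse_holder`). -/

/-- `β ^ n * x - T^n x`, which is constant on each cylinder of order `n` and takes different values
on different cylinders. -/
noncomputable def branchVal (β : ℝ) (n : ℕ) (x : ℝ) : ℝ := β ^ n * x - (betaMap β)^[n] x

/-- `a` labels a branch of `T^n` that maps `[a / β ^ n, (a + 1) / β ^ n)` affinely onto `[0, 1)`. -/
def IsFullBranch (β : ℝ) (n : ℕ) (a : ℝ) : Prop :=
  ∀ y ∈ Set.Ico (0 : ℝ) 1,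
    (a + y) / β ^ n ∈ Set.Ico (0 : ℝ) 1 ∧ (betaMap β)^[n] ((a + y) / β ^ n) = y

theorem betaMap_mem_Ico (β x : ℝ) : betaMap β x ∈ Set.Ico (0 : ℝ) 1 :=
  ⟨Int.fract_nonneg _, Int.fract_lt_one _⟩

theorem iterate_betaMap_mem_Ico (β : ℝ) (n : ℕ) {x : ℝ} (hx : x ∈ Set.Ico (0 : ℝ) 1) :
    (betaMap β)^[n] x ∈ Set.Ico (0 : ℝ) 1 := by
  cases n with
  | zero => simpa using hx
  | succ n => rw [Function.iterate_succ_apply']; exact betaMap_mem_Ico _ _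

theorem branchVal_zero (β x : ℝ) : branchVal β 0 x = 0 := by simp [branchVal]

theorem branchVal_succ (β : ℝ) (n : ℕ) (x : ℝ) :
    branchVal β (n + 1) x = β * branchVal β n x + ⌊β * (betaMap β)^[n] x⌋ := by
  unfold branchVal
  rw [Function.iterate_succ_apply', betaMap, ← Int.self_sub_floor]
  ring

theorem floor_mul_iterate_nonneg {β : ℝ} (hβ : 1 < β) (n : ℕ) {x : ℝ}
    (hx : x ∈ Set.Ico (0 : ℝ) 1) : 0 ≤ ⌊β * (betaMap β)^[n] x⌋ :=
  Int.floor_nonneg.2 (mul_nonneg (by linarith) (iterate_betaMap_mem_Ico β n hx).1)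

theorem branchVal_nonneg {β : ℝ} (hβ : 1 < β) (n : ℕ) {x : ℝ} (hx : x ∈ Set.Ico (0 : ℝ) 1) :
    0 ≤ branchVal β n x := by
  induction n with
  | zero => rw [branchVal_zero]
  | succ n ih =>
    rw [branchVal_succ]
    have h : (0 : ℝ) ≤ ⌊β * (betaMap β)^[n] x⌋ := by
      exact_mod_cast floor_mul_iterate_nonneg hβ n hx
    have : 0 ≤ β * branchVal β n x := mul_nonneg (by linarith) ih
    linarith

theorem branchVal_le_mul (β : ℝ) (n : ℕ) {x : ℝ} (hx : x ∈ Set.Ico (0 : ℝ) 1) :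
    branchVal β n x ≤ β ^ n * x := by
  have := (iterate_betaMap_mem_Ico β n hx).1
  unfold branchVal; linarith

theorem mul_lt_branchVal_add_one (β : ℝ) (n : ℕ) {x : ℝ} (hx : x ∈ Set.Ico (0 : ℝ) 1) :
    β ^ n * x < branchVal β n x + 1 := by
  have := (iterate_betaMap_mem_Ico β n hx).2
  unfold branchVal; linarith

theorem iterate_eq_sub_branchVal (β : ℝ) (n : ℕ) (x : ℝ) :
    (betaMap β)^[n] x = β ^ n * x - branchVal β n x := by
  unfold branchVal; ring

/-- A cylinder contains the whole interval between its left endpoint and any of its points. -/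
theorem branchVal_eq_of_le {β : ℝ} (hβ : 1 < β) (n : ℕ) {x y : ℝ} (hx : x ∈ Set.Ico (0 : ℝ) 1)
    (hyx : y ≤ x) (hy : branchVal β n x ≤ β ^ n * y) : branchVal β n y = branchVal β n x := by
  induction n with
  | zero => simp [branchVal_zero]
  | succ n ih =>
    have hβ0 : 0 < β := by linarith
    have hj : (0 : ℝ) ≤ ⌊β * (betaMap β)^[n] x⌋ := by
      exact_mod_cast floor_mul_iterate_nonneg hβ n hx
    rw [branchVal_succ] at hy
    have h1 : branchVal β n x ≤ β ^ n * y := by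
      have : β * branchVal β n x ≤ β * (β ^ n * y) := by rw [pow_succ] at hy; linarith
      exact le_of_mul_le_mul_left this hβ0
    have ih := ih h1
    rw [branchVal_succ, branchVal_succ, ih]
    congr 2
    rw [Int.floor_eq_iff]
    constructor
    · rw [iterate_eq_sub_branchVal β n y, ih]
      rw [pow_succ] at hy; linarith
    · refine lt_of_le_of_lt ?_ (Int.lt_floor_add_one _)
      rw [iterate_eq_sub_branchVal β n y, iterate_eq_sub_branchVal β n x, ih]
      gcongr

theorem IsFullBranch.branchVal_eq {β : ℝ} (hβ : 1 < β) {n : ℕ} {a y : ℝ}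
    (ha : IsFullBranch β n a) (hy : y ∈ Set.Ico (0 : ℝ) 1) :
    branchVal β n ((a + y) / β ^ n) = a := by
  have : β ^ n ≠ 0 := by positivity
  rw [branchVal, (ha y hy).2]
  field_simp
  ring

theorem IsFullBranch.iterate_eq {β : ℝ} (hβ : 1 < β) {n : ℕ} {a x : ℝ}
    (ha : IsFullBranch β n a) (h1 : a ≤ β ^ n * x) (h2 : β ^ n * x < a + 1) :
    x ∈ Set.Ico (0 : ℝ) 1 ∧ (betaMap β)^[n] x = β ^ n * x - a := by
  have h0 : β ^ n ≠ 0 := by positivity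
  have := ha (β ^ n * x - a) ⟨by linarith, by linarith⟩
  have e : (a + (β ^ n * x - a)) / β ^ n = x := by field_simp; ring
  rwa [e] at this

/-- On `[0, β^(-n))` multiplication by `β` never wraps around. Composing with this branch appends
zeros to a full cylinder without losing fullness. -/
theorem isFullBranch_zero {β : ℝ} (hβ : 1 < β) (n : ℕ) : IsFullBranch β n 0 := by
  intro y hy
  have h0 : 1 ≤ β ^ n := one_le_pow₀ hβ.le
  have hx : (0 + y) / β ^ n ∈ Set.Ico (0 : ℝ) 1 := by
    rw [zero_add]
    exact ⟨div_nonneg hy.1 (by linarith), (div_le_self hy.1 h0).trans_lt hy.2⟩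
  refine ⟨hx, ?_⟩
  have : branchVal β n ((0 + y) / β ^ n) = 0 := by
    have hz : branchVal β n 0 = 0 := by
      refine le_antisymm ?_ (branchVal_nonneg hβ n ⟨le_rfl, one_pos⟩)
      simpa using branchVal_le_mul β n (x := 0) ⟨le_rfl, one_pos⟩
    induction n with
    | zero => simp [branchVal_zero]
    | succ n ih =>
      have hb : 0 < β := by linarith
      have h1 : 1 ≤ β ^ n := one_le_pow₀ hβ.le
      rw [branchVal_succ]
      set x := (0 + y) / β ^ (n + 1) with hxdef
      have key : ∀ m ≤ n, (betaMap β)^[m] x = β ^ m * x := by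
        intro m
        induction m with
        | zero => simp
        | succ m ihm =>
          intro hm
          rw [Function.iterate_succ_apply', ihm (by omega), betaMap]
          rw [Int.fract_eq_self.2]
          · ring
          · refine ⟨mul_nonneg hb.le (mul_nonneg (by positivity) hx.1), ?_⟩
            have : β * (β ^ m * x) ≤ y := by
              have e : y = β ^ (n + 1) * x := by rw [hxdef]; field_simp; ring
              rw [e, ← mul_assoc, ← pow_succ']
              exact mul_le_mul_of_nonneg_right (pow_le_pow_right₀ hβ.le (by omega)) hx.1
            linarith [hy.2]
      have e : y = β * (β ^ n * x) := by rw [hxdef]; field_simp; ring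
      rw [key n le_rfl, ← e, Int.floor_eq_zero_iff.2 hy]
      simp [branchVal, key n le_rfl]
  rw [iterate_eq_sub_branchVal, this]
  field_simp
  ring

theorem IsFullBranch.comp {β : ℝ} (hβ : 1 < β) {n m : ℕ} {a b : ℝ} (ha : IsFullBranch β n a)
    (hb : IsFullBranch β m b) : IsFullBranch β (n + m) (β ^ m * a + b) := by
  intro y hy
  obtain ⟨h1, h2⟩ := hb y hy
  obtain ⟨h3, h4⟩ := ha _ h1
  have e : (β ^ m * a + b + y) / β ^ (n + m) = (a + (b + y) / β ^ m) / β ^ n := by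
    have : β ≠ 0 := by linarith
    rw [pow_add]; field_simp
    ring
  rw [e]
  refine ⟨h3, ?_⟩
  rw [add_comm, Function.iterate_add_apply, h4, h2]

/-- A cylinder is full unless it is the rightmost one inside its parent. -/
theorem isFullBranch_of_branchVal_lt {β : ℝ} (hβ : 1 < β) (n : ℕ) {x y : ℝ}
    (hy : y ∈ Set.Ico (0 : ℝ) 1) (hx : x ∈ Set.Ico (0 : ℝ) 1)
    (h : branchVal β n x = branchVal β n y)
    (hlt : branchVal β (n + 1) x < branchVal β (n + 1) y) :
    IsFullBranch β (n + 1) (branchVal β (n + 1) x) := by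
  intro z hz
  have hb : 0 < β := by linarith
  have hp : 0 < β ^ (n + 1) := by positivity
  set i := ⌊β * (betaMap β)^[n] x⌋ with hi
  set j := ⌊β * (betaMap β)^[n] y⌋ with hj
  have ex : branchVal β (n + 1) x = β * branchVal β n y + i := by rw [branchVal_succ, h]
  have ey : branchVal β (n + 1) y = β * branchVal β n y + j := by rw [branchVal_succ]
  have hij : i + 1 ≤ j := by
    rw [ex, ey] at hlt
    have : (i : ℝ) < j := by linarith
    exact_mod_cast this
  have hij' : (i : ℝ) + 1 ≤ j := by exact_mod_cast hij
  have hi0 : (0 : ℝ) ≤ i := by exact_mod_cast floor_mul_iterate_nonneg hβ n hx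
  set u := (branchVal β (n + 1) x + z) / β ^ (n + 1) with hu
  have hu' : β ^ (n + 1) * u = branchVal β (n + 1) x + z := by rw [hu]; field_simp
  have huy : u ≤ y := by
    have : β ^ (n + 1) * u ≤ β ^ (n + 1) * y := by
      have := branchVal_le_mul β (n + 1) hy
      rw [hu', ex]; rw [ey] at this; linarith [hz.2]
    exact le_of_mul_le_mul_left this hp
  have hu0 : 0 ≤ u := div_nonneg (add_nonneg (branchVal_nonneg hβ _ hx) hz.1) hp.le
  refine ⟨⟨hu0, huy.trans_lt hy.2⟩, ?_⟩
  have hbu : branchVal β n u = branchVal β n y := by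
    refine branchVal_eq_of_le hβ n hy huy ?_
    have : β * branchVal β n y ≤ β * (β ^ n * u) := by
      rw [← mul_assoc, ← pow_succ', hu', ex]; linarith [hz.1]
    exact le_of_mul_le_mul_left this hb
  rw [Function.iterate_succ_apply', betaMap, iterate_eq_sub_branchVal, hbu]
  have : β * (β ^ n * u - branchVal β n y) = i + z := by
    rw [mul_sub, ← mul_assoc, ← pow_succ', hu', ex]; ring
  rw [this, Int.fract_intCast_add, Int.fract_eq_self.2 hz]

/-- A label at distance less than 1 above `a` would place the left end of its cylinder inside the
full cylinder of `a`, where the label is `a`. -/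
theorem IsFullBranch.add_one_le {β : ℝ} (hβ : 1 < β) {n : ℕ} {a x : ℝ} (ha : IsFullBranch β n a)
    (hx : x ∈ Set.Ico (0 : ℝ) 1) (h : a < branchVal β n x) : a + 1 ≤ branchVal β n x := by
  by_contra! hlt
  have hp : 0 < β ^ n := by positivity
  have hy : branchVal β n x - a ∈ Set.Ico (0 : ℝ) 1 := ⟨by linarith, by linarith⟩
  have h1 := ha.branchVal_eq hβ hy
  have e : a + (branchVal β n x - a) = branchVal β n x := by ring
  rw [e] at h1
  have h2 := branchVal_eq_of_le hβ n (x := x) (y := branchVal β n x / β ^ n) hx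
    (by rw [div_le_iff₀ hp, mul_comm]; exact branchVal_le_mul β n hx) (by field_simp; rfl)
  linarith

theorem IsFullBranch.add_one_le' {β : ℝ} (hβ : 1 < β) {n : ℕ} {a b : ℝ} (ha : IsFullBranch β n a)
    (hb : IsFullBranch β n b) (h : a < b) : a + 1 ≤ b := by
  have h0 : (0 : ℝ) ∈ Set.Ico (0 : ℝ) 1 := ⟨le_rfl, one_pos⟩
  have := ha.add_one_le hβ (hb 0 h0).1
  rw [hb.branchVal_eq hβ h0] at this
  exact this h

theorem IsFullBranch.nonneg {β : ℝ} (hβ : 1 < β) {n : ℕ} {a : ℝ} (ha : IsFullBranch β n a) :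
    0 ≤ a := by
  have h0 : (0 : ℝ) ∈ Set.Ico (0 : ℝ) 1 := ⟨le_rfl, one_pos⟩
  have := branchVal_nonneg hβ n (ha 0 h0).1
  rwa [ha.branchVal_eq hβ h0] at this

theorem IsFullBranch.add_one_le_pow {β : ℝ} (hβ : 1 < β) {n : ℕ} {a : ℝ}
    (ha : IsFullBranch β n a) : a + 1 ≤ β ^ n := by
  have hp : 0 < β ^ n := by positivity
  refine le_of_forall_lt fun c hc => ?_
  rcases lt_or_ge c a with h | h
  · have := (ha 0 ⟨le_rfl, one_pos⟩).1.2
    rw [add_zero, div_lt_one hp] at this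
    linarith
  · have := (ha (c - a) ⟨by linarith, by linarith⟩).1.2
    rw [div_lt_one hp] at this
    linarith

/-! ### Counting cylinders and full cylinders -/

theorem finite_branchVal_image (β : ℝ) (n : ℕ) {J : Set ℝ} (hJ : J ⊆ Set.Ico (0 : ℝ) 1) :
    (branchVal β n '' J).Finite := by
  refine Set.Finite.subset ?_ (Set.image_mono hJ)
  clear hJ J
  induction n with
  | zero =>
    refine (Set.finite_singleton (0 : ℝ)).subset ?_
    rintro _ ⟨x, -, rfl⟩
    exact branchVal_zero β x
  | succ n ih =>
    refine (Set.Finite.image2 (fun (a : ℝ) (j : ℤ) => β * a + j) ih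
      (Set.finite_Icc (-⌈|β|⌉) ⌈|β|⌉)).subset ?_
    rintro _ ⟨x, hx, rfl⟩
    have hT := iterate_betaMap_mem_Ico β n hx
    refine ⟨_, ⟨x, hx, rfl⟩, ⌊β * (betaMap β)^[n] x⌋, ?_, (branchVal_succ β n x).symm⟩
    have hab : |β * (betaMap β)^[n] x| ≤ |β| := by
      rw [abs_mul, abs_of_nonneg hT.1]
      exact mul_le_of_le_one_right (abs_nonneg _) hT.2.le
    have hc := Int.le_ceil |β|
    rw [abs_le] at hab
    constructor
    · rw [Int.le_floor]; push_cast; linarith [hab.1]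
    · have := Int.floor_le (β * (betaMap β)^[n] x)
      have : (⌊β * (betaMap β)^[n] x⌋ : ℝ) ≤ ⌈|β|⌉ := by linarith [hab.2]
      exact_mod_cast this

/-- The labels of the full branches of `T^n` that meet `J`. -/
def fullBranches (β : ℝ) (n : ℕ) (J : Set ℝ) : Set ℝ :=
  {a | a ∈ branchVal β n '' J ∧ IsFullBranch β n a}

theorem finite_fullBranches (β : ℝ) (n : ℕ) {J : Set ℝ} (hJ : J ⊆ Set.Ico (0 : ℝ) 1) :
    (fullBranches β n J).Finite :=
  (finite_branchVal_image β n hJ).subset fun _ h => h.1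

/-- Non-full cylinders inject into their parents: of two children of one parent, the left one is
full. -/
theorem ncard_branchVal_image_succ_le {β : ℝ} (hβ : 1 < β) (n : ℕ) {J : Set ℝ}
    (hJ : J ⊆ Set.Ico (0 : ℝ) 1) :
    (branchVal β (n + 1) '' J).ncard ≤
      (fullBranches β (n + 1) J).ncard + (branchVal β n '' J).ncard := by
  have hfin := finite_branchVal_image β (n + 1) hJ
  have hsplit : branchVal β (n + 1) '' J ⊆
      fullBranches β (n + 1) J ∪ {a | a ∈ branchVal β (n + 1) '' J ∧ ¬ IsFullBranch β (n + 1) a} := by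
    intro a ha
    by_cases h : IsFullBranch β (n + 1) a
    · exact Or.inl ⟨ha, h⟩
    · exact Or.inr ⟨ha, h⟩
  have hfin2 : {a | a ∈ branchVal β (n + 1) '' J ∧ ¬ IsFullBranch β (n + 1) a}.Finite :=
    hfin.subset fun _ h => h.1
  refine (Set.ncard_le_ncard hsplit ((finite_fullBranches β _ hJ).union hfin2)).trans
    ((Set.ncard_union_le _ _).trans (Nat.add_le_add_left ?_ _))
  have hch : ∀ a : ℝ, ∃ x, a ∈ branchVal β (n + 1) '' J → x ∈ J ∧ branchVal β (n + 1) x = a := by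
    intro a
    by_cases h : a ∈ branchVal β (n + 1) '' J
    · obtain ⟨x, hx⟩ := h; exact ⟨x, fun _ => hx⟩
    · exact ⟨0, fun h' => absurd h' h⟩
  choose p hp using hch
  refine Set.ncard_le_ncard_of_injOn (fun a => branchVal β n (p a)) ?_ ?_
    (finite_branchVal_image β n hJ)
  · intro a ha
    exact ⟨p a, (hp a ha.1).1, rfl⟩
  · intro a ha b hb hab
    obtain ⟨ha1, ha2⟩ := hp a ha.1
    obtain ⟨hb1, hb2⟩ := hp b hb.1
    rcases lt_trichotomy a b with h | h | h
    · refine absurd ?_ ha.2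
      rw [← ha2]
      exact isFullBranch_of_branchVal_lt hβ n (hJ hb1) (hJ ha1) hab (by rwa [ha2, hb2])
    · exact h
    · refine absurd ?_ hb.2
      rw [← hb2]
      exact isFullBranch_of_branchVal_lt hβ n (hJ ha1) (hJ hb1) hab.symm (by rwa [ha2, hb2])

theorem ncard_le_of_separated {S : Set ℝ} {u v : ℝ} (huv : u ≤ v) (hS : S ⊆ Set.Icc u v)
    (hsep : ∀ a ∈ S, ∀ b ∈ S, a < b → a + 1 ≤ b) : (S.ncard : ℝ) ≤ v - u + 2 := by
  have h1 : S.ncard ≤ (Set.Icc ⌊u⌋ ⌊v⌋).ncard := by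
    refine Set.ncard_le_ncard_of_injOn (fun a => ⌊a⌋) ?_ ?_ (Set.finite_Icc _ _)
    · intro a ha
      exact ⟨Int.floor_mono (hS ha).1, Int.floor_mono (hS ha).2⟩
    · intro a ha b hb hab
      have key : ∀ a ∈ S, ∀ b ∈ S, a < b → ⌊a⌋ ≠ ⌊b⌋ := by
        intro a ha b hb h
        have : ⌊a⌋ + 1 ≤ ⌊b⌋ := by
          rw [← Int.floor_add_one]; exact Int.floor_mono (hsep a ha b hb h)
        omega
      rcases lt_trichotomy a b with h | h | h
      · exact absurd hab (key a ha b hb h)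
      · exact h
      · exact absurd hab.symm (key b hb a ha h)
  have h2 : (Set.Icc ⌊u⌋ ⌊v⌋).ncard = (⌊v⌋ + 1 - ⌊u⌋).toNat := by
    rw [Set.ncard_eq_toFinset_card']; simp
  have h3 : ⌊u⌋ ≤ ⌊v⌋ := Int.floor_mono huv
  have h4 : ((⌊v⌋ + 1 - ⌊u⌋).toNat : ℝ) = ⌊v⌋ + 1 - ⌊u⌋ := by
    have : (((⌊v⌋ + 1 - ⌊u⌋).toNat : ℤ) : ℝ) = ((⌊v⌋ + 1 - ⌊u⌋ : ℤ) : ℝ) := by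
      rw [Int.toNat_of_nonneg (by omega)]
    push_cast at this; exact this
  have h5 : (S.ncard : ℝ) ≤ ⌊v⌋ + 1 - ⌊u⌋ := by
    rw [← h4]; exact_mod_cast h1.trans h2.le
  have := Int.floor_le v
  have := Int.lt_floor_add_one u
  linarith

theorem ncard_fullBranches_le {β : ℝ} (hβ : 1 < β) (n : ℕ) {J : Set ℝ} {u ℓ : ℝ} (hℓ : 0 ≤ ℓ)
    (hJ : J ⊆ Set.Ico (0 : ℝ) 1) (hJu : J ⊆ Set.Icc u (u + ℓ)) :
    ((fullBranches β n J).ncard : ℝ) ≤ β ^ n * ℓ + 3 := by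
  have hp : 0 < β ^ n := by positivity
  -- A cylinder that meets `J` may begin up to one unit of label before `β ^ n * u`; this adds 1 to
  -- the 2 of the separation bound.
  have := ncard_le_of_separated (S := fullBranches β n J) (u := β ^ n * u - 1)
    (v := β ^ n * (u + ℓ)) (by nlinarith [mul_nonneg hp.le hℓ]) ?_ ?_
  · linarith
  · rintro _ ⟨⟨x, hx, rfl⟩, -⟩
    have h1 := mul_lt_branchVal_add_one β n (hJ hx)
    have h2 := branchVal_le_mul β n (hJ hx)
    have h3 := mul_le_mul_of_nonneg_left (hJu hx).1 hp.le
    have h4 := mul_le_mul_of_nonneg_left (hJu hx).2 hp.le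
    exact ⟨by linarith, by linarith⟩
  · rintro a ⟨-, ha⟩ b ⟨-, hb⟩ hab
    exact ha.add_one_le' hβ hb hab

theorem ncard_branchVal_image_zero_le (β : ℝ) (J : Set ℝ) : (branchVal β 0 '' J).ncard ≤ 1 := by
  rw [← Set.ncard_singleton (0 : ℝ)]
  refine Set.ncard_le_ncard ?_
  rintro _ ⟨x, -, rfl⟩
  exact branchVal_zero β x

/-- An interval of length `ℓ` meets at most `O(β ^ n * ℓ + n)` cylinders of order `n`. -/
theorem ncard_branchVal_image_le {β : ℝ} (hβ : 1 < β) (n : ℕ) {J : Set ℝ} {u ℓ : ℝ} (hℓ : 0 ≤ ℓ)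
    (hJ : J ⊆ Set.Ico (0 : ℝ) 1) (hJu : J ⊆ Set.Icc u (u + ℓ)) :
    ((branchVal β n '' J).ncard : ℝ) ≤ β / (β - 1) * (β ^ n * ℓ) + 3 * (n + 1) := by
  have hb : 0 < β - 1 := by linarith
  induction n with
  | zero =>
    have h1 : ((branchVal β 0 '' J).ncard : ℝ) ≤ 1 := by
      exact_mod_cast ncard_branchVal_image_zero_le β J
    have : 0 ≤ β / (β - 1) * (β ^ 0 * ℓ) := by positivity
    push_cast; linarith
  | succ n ih =>
    have h1 : ((branchVal β (n + 1) '' J).ncard : ℝ) ≤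
        (fullBranches β (n + 1) J).ncard + (branchVal β n '' J).ncard := by
      exact_mod_cast ncard_branchVal_image_succ_le hβ n hJ
    have h2 := ncard_fullBranches_le hβ (n + 1) hℓ hJ hJu
    -- `β / (β - 1)` is the sum of the powers of `1 / β`, hence the constant that the recursion
    -- reproduces.
    have e : β / (β - 1) * (β ^ (n + 1) * ℓ) = β ^ (n + 1) * ℓ + β / (β - 1) * (β ^ n * ℓ) := by
      rw [pow_succ]; field_simp; ring
    rw [e]; push_cast; linarith

/-- Cylinders of order `n` have length at most `β ^ (-n)`. -/
theorem mul_le_ncard_branchVal_image {β : ℝ} (hβ : 1 < β) (n : ℕ) {u δ : ℝ}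
    (hJ : Set.Ico u (u + δ) ⊆ Set.Ico (0 : ℝ) 1) :
    β ^ n * δ ≤ (branchVal β n '' Set.Ico u (u + δ)).ncard := by
  have hp : 0 < β ^ n := by positivity
  set F := (finite_branchVal_image β n hJ).toFinset with hF
  have hsub : Set.Ico u (u + δ) ⊆ ⋃ a ∈ F, Set.Ico (a / β ^ n) ((a + 1) / β ^ n) := by
    intro x hx
    refine Set.mem_biUnion (x := branchVal β n x) ?_ ?_
    · simp only [hF, Set.Finite.coe_toFinset]; exact ⟨x, hx, rfl⟩
    · have h1 := mul_lt_branchVal_add_one β n (hJ hx)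
      have h2 := branchVal_le_mul β n (hJ hx)
      exact ⟨by rw [div_le_iff₀ hp]; linarith, by rw [lt_div_iff₀ hp]; linarith⟩
  have h1 := (measure_mono hsub).trans (measure_biUnion_finset_le (μ := volume) F _)
  simp only [Real.volume_Ico] at h1
  have e : ∀ a : ℝ, (a + 1) / β ^ n - a / β ^ n = 1 / β ^ n := fun a => by ring
  simp only [e, Finset.sum_const, nsmul_eq_mul, add_sub_cancel_left] at h1
  have e2 : (F.card : ℝ≥0∞) * ENNReal.ofReal (1 / β ^ n)
      = ENNReal.ofReal (F.card * (1 / β ^ n)) := by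
    rw [ENNReal.ofReal_mul (by positivity), ENNReal.ofReal_natCast]
  rw [e2, ENNReal.ofReal_le_ofReal_iff (by positivity)] at h1
  rw [Set.ncard_eq_toFinset_card _ (finite_branchVal_image β n hJ), ← hF]
  have := mul_le_mul_of_nonneg_left h1 hp.le
  have e3 : β ^ n * (F.card * (1 / β ^ n)) = F.card := by field_simp
  linarith

theorem ncard_branchVal_image_le_sum {β : ℝ} (hβ : 1 < β) (n : ℕ) {J : Set ℝ}
    (hJ : J ⊆ Set.Ico (0 : ℝ) 1) :
    (branchVal β n '' J).ncard ≤
      1 + ∑ i ∈ Finset.range n, (fullBranches β (i + 1) J).ncard := by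
  induction n with
  | zero => simpa using ncard_branchVal_image_zero_le β J
  | succ n ih =>
    rw [Finset.sum_range_succ]
    have := ncard_branchVal_image_succ_le hβ n hJ
    omega

theorem ncard_fullBranches_mono {β : ℝ} (hβ : 1 < β) {i n : ℕ} (hin : i ≤ n) :
    (fullBranches β i (Set.Ico 0 1)).ncard ≤ (fullBranches β n (Set.Ico 0 1)).ncard := by
  obtain ⟨m, rfl⟩ := Nat.exists_eq_add_of_le hin
  have h0 : (0 : ℝ) ∈ Set.Ico (0 : ℝ) 1 := ⟨le_rfl, one_pos⟩
  refine Set.ncard_le_ncard_of_injOn (fun a => β ^ m * a + 0) ?_ ?_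
    (finite_fullBranches β _ le_rfl)
  · rintro a ⟨-, ha⟩
    have := ha.comp hβ (isFullBranch_zero hβ m)
    exact ⟨⟨_, (this 0 h0).1, this.branchVal_eq hβ h0⟩, this⟩
  · intro a _ b _ hab
    have : β ^ m ≠ 0 := by positivity
    simpa [this] using hab

/-- There are at least `β ^ n` cylinders, and following non-full ones back to their ancestors
charges all but one to full cylinders of orders `1, …, n`, whose numbers increase with the order. -/
theorem pow_sub_one_le_mul_ncard_fullBranches {β : ℝ} (hβ : 1 < β) (n : ℕ) :
    β ^ n - 1 ≤ n * (fullBranches β n (Set.Ico 0 1)).ncard := by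
  have h1 := mul_le_ncard_branchVal_image hβ n (u := 0) (δ := 1) (by simp)
  have h2 := ncard_branchVal_image_le_sum hβ n (J := Set.Ico 0 1) le_rfl
  have h3 : ∑ i ∈ Finset.range n, (fullBranches β (i + 1) (Set.Ico 0 1)).ncard ≤
      ∑ i ∈ Finset.range n, (fullBranches β n (Set.Ico 0 1)).ncard :=
    Finset.sum_le_sum fun i hi => ncard_fullBranches_mono hβ (by
      have := Finset.mem_range.1 hi; omega)
  rw [Finset.sum_const, Finset.card_range, smul_eq_mul] at h3
  have h4 : ((branchVal β n '' Set.Ico 0 1).ncard : ℝ) ≤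
      1 + n * (fullBranches β n (Set.Ico 0 1)).ncard := by
    exact_mod_cast h2.trans (Nat.add_le_add_left h3 1)
  rw [zero_add, mul_one] at h1
  linarith

/-- An interval that is not too short contains a full cylinder of order `j`. -/
theorem exists_isFullBranch_subset {β : ℝ} (hβ : 1 < β) {j : ℕ} {u δ : ℝ} (hu : 0 ≤ u)
    (hu1 : u + δ ≤ 1) (hj : 2 * j + 1 < β ^ j * δ) :
    ∃ b, IsFullBranch β j b ∧ β ^ j * u ≤ b ∧ b + 1 ≤ β ^ j * (u + δ) := by
  have hJ : Set.Ico u (u + δ) ⊆ Set.Ico (0 : ℝ) 1 := Set.Ico_subset_Ico hu hu1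
  by_contra! hno
  -- Appending zeros to a full cylinder of smaller order inside the interval would give one of order
  -- `j`.
  have hno' : ∀ i ≤ j, ∀ b, IsFullBranch β i b → β ^ i * u ≤ b → β ^ i * (u + δ) < b + 1 := by
    intro i hi b hb hub
    obtain ⟨m, rfl⟩ := Nat.exists_eq_add_of_le hi
    have hm : 1 ≤ β ^ m := one_le_pow₀ hβ.le
    have := hno _ (hb.comp hβ (isFullBranch_zero hβ m)) (by
      rw [pow_add, add_zero, mul_comm (β ^ i), mul_assoc]
      exact mul_le_mul_of_nonneg_left hub (by linarith))
    rw [pow_add, add_zero, mul_comm (β ^ i), mul_assoc] at this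
    have h2 : β ^ m * (β ^ i * (u + δ)) < β ^ m * (b + 1) := by linarith
    exact lt_of_mul_lt_mul_left h2 (by linarith)
  -- A full cylinder meeting the interval must therefore straddle one of its two ends. This leaves
  -- at most `1 + 2 * j` cylinders of order `j`, too few to cover it.
  have hcard : ∀ i ≤ j, (fullBranches β i (Set.Ico u (u + δ))).ncard ≤ 2 := by
    intro i hi
    have hp : 0 < β ^ i := by positivity
    have hsub : fullBranches β i (Set.Ico u (u + δ)) ⊆
        {a | IsFullBranch β i a ∧ a < β ^ i * u ∧ β ^ i * u < a + 1} ∪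
        {a | IsFullBranch β i a ∧ a < β ^ i * (u + δ) ∧ β ^ i * (u + δ) < a + 1} := by
      rintro _ ⟨⟨x, hx, rfl⟩, hfull⟩
      have h1 := mul_lt_branchVal_add_one β i (hJ hx)
      have h2 := branchVal_le_mul β i (hJ hx)
      have h3 := mul_le_mul_of_nonneg_left hx.1 hp.le
      have h4 := mul_lt_mul_of_pos_left hx.2 hp
      by_cases h : β ^ i * u ≤ branchVal β i x
      · exact Or.inr ⟨hfull, by linarith, hno' i hi _ hfull h⟩
      · exact Or.inl ⟨hfull, by linarith, by linarith⟩
    have hss : ∀ v : ℝ, {a | IsFullBranch β i a ∧ a < v ∧ v < a + 1}.Subsingleton := by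
      rintro v a ⟨ha, ha1, ha2⟩ b ⟨hb, hb1, hb2⟩
      rcases lt_trichotomy a b with h | h | h
      · have := ha.add_one_le' hβ hb h; linarith
      · exact h
      · have := hb.add_one_le' hβ ha h; linarith
    refine (Set.ncard_le_ncard hsub ((hss _).finite.union (hss _).finite)).trans
      ((Set.ncard_union_le _ _).trans ?_)
    have h1 := (Set.ncard_le_one (hss (β ^ i * u)).finite).2 (fun a ha b hb => hss _ ha hb)
    have h2 := (Set.ncard_le_one (hss (β ^ i * (u + δ))).finite).2 (fun a ha b hb => hss _ ha hb)
    omega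
  have h1 := mul_le_ncard_branchVal_image hβ j hJ
  have h2 := ncard_branchVal_image_le_sum hβ j hJ
  have h3 : ∑ i ∈ Finset.range j, (fullBranches β (i + 1) (Set.Ico u (u + δ))).ncard ≤
      ∑ i ∈ Finset.range j, 2 :=
    Finset.sum_le_sum fun i hi => hcard _ (by have := Finset.mem_range.1 hi; omega)
  rw [Finset.sum_const, Finset.card_range, smul_eq_mul] at h3
  have h4 : ((branchVal β j '' Set.Ico u (u + δ)).ncard : ℝ) ≤ 1 + j * 2 := by
    exact_mod_cast h2.trans (Nat.add_le_add_left h3 1)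
  linarith

/-! ### Covering the points with prescribed near-return times -/

/-- The points of `[0, 1)` whose first `k` prescribed near-returns, at the times `n i`, are at
distance at most `β ^ (-h * n (i + 1))`. -/
def nearReturnSet (β h : ℝ) (n : ℕ → ℕ) (k : ℕ) : Set ℝ :=
  {x | x ∈ Set.Ico (0 : ℝ) 1 ∧ ∀ i < k, |(betaMap β)^[n i] x - x| ≤ β ^ (-(h * n (i + 1)))}

/-- The number of digits, among the first `n k` ones, that are left free by the near-returns at the
times `n i`, `i < k`. -/
noncomputable def freeDigits (h : ℝ) (n : ℕ → ℕ) : ℕ → ℝ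
  | 0 => n 0
  | k + 1 => freeDigits h n k + max ((1 - h) * n (k + 1) - n k) 0

theorem freeDigits_congr (h : ℝ) {n m : ℕ → ℕ} {k : ℕ} (hnm : ∀ i ≤ k, n i = m i) :
    freeDigits h n k = freeDigits h m k := by
  induction k with
  | zero => simp [freeDigits, hnm 0 le_rfl]
  | succ k ih =>
    rw [freeDigits, freeDigits, ih fun i hi => hnm i (by omega), hnm _ le_rfl, hnm k (by omega)]

theorem nearReturnSet_subset_Ico (β h : ℝ) (n : ℕ → ℕ) (k : ℕ) :
    nearReturnSet β h n k ⊆ Set.Ico (0 : ℝ) 1 := fun _ hx => hx.1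

/-- Points of one cylinder of order `n` that return within `δ` at time `n` are close. -/
theorem abs_sub_le_of_branchVal_eq {β : ℝ} (hβ : 1 < β) {n : ℕ} (hn : 1 ≤ n) {x y δ : ℝ}
    (hxy : branchVal β n x = branchVal β n y) (hx : |(betaMap β)^[n] x - x| ≤ δ)
    (hy : |(betaMap β)^[n] y - y| ≤ δ) : |x - y| ≤ 2 * β / (β - 1) * (δ / β ^ n) := by
  have hb : 0 < β - 1 := by linarith
  have hp : 0 < β ^ n := by positivity
  have hβn : β ≤ β ^ n := by simpa using pow_le_pow_right₀ hβ.le hn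
  -- On a cylinder the displacement `T^n x - x` is affine of slope `β ^ n - 1`.
  have h1 : (β ^ n - 1) * (x - y) =
      ((betaMap β)^[n] x - x) - ((betaMap β)^[n] y - y) := by
    rw [iterate_eq_sub_branchVal β n x, iterate_eq_sub_branchVal β n y, hxy]; ring
  have h2 : (β ^ n - 1) * |x - y| ≤ 2 * δ := by
    rw [← abs_of_pos (show 0 < β ^ n - 1 by linarith), ← abs_mul, h1]
    refine (abs_sub _ _).trans ?_
    linarith
  have h3 : (β - 1) / β * β ^ n ≤ β ^ n - 1 := by
    rw [div_mul_eq_mul_div, div_le_iff₀ (by linarith)]; nlinarith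
  have h4 : (β - 1) / β * β ^ n * |x - y| ≤ 2 * δ :=
    (mul_le_mul_of_nonneg_right h3 (abs_nonneg _)).trans h2
  have e : 2 * β / (β - 1) * (δ / β ^ n) = 2 * δ / ((β - 1) / β * β ^ n) := by
    field_simp
  rw [e, le_div_iff₀ (by positivity)]
  linarith

theorem abs_sub_le_of_mem_nearReturnSet {β h : ℝ} (hβ : 1 < β) {n : ℕ → ℕ} {k : ℕ} (hn : 1 ≤ n k)
    {x y : ℝ} (hx : x ∈ nearReturnSet β h n (k + 1)) (hy : y ∈ nearReturnSet β h n (k + 1))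
    (hxy : branchVal β (n k) x = branchVal β (n k) y) :
    |x - y| ≤ 2 * β / (β - 1) * β ^ (-(n k + h * n (k + 1))) := by
  have := abs_sub_le_of_branchVal_eq hβ hn hxy (hx.2 k (by omega)) (hy.2 k (by omega))
  have e : β ^ (-(n k + h * n (k + 1))) = β ^ (-(h * n (k + 1))) / β ^ n k := by
    rw [neg_add_rev, Real.rpow_add (by linarith), Real.rpow_neg (by linarith) (n k : ℝ),
      Real.rpow_natCast]
    rfl
  rwa [e]

theorem nearReturnSet_anti (β h : ℝ) (n : ℕ → ℕ) (k : ℕ) :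
    nearReturnSet β h n (k + 1) ⊆ nearReturnSet β h n k :=
  fun _ hx => ⟨hx.1, fun i hi => hx.2 i (by omega)⟩

/-- Inside one cylinder of order `n k` the admissible points fill an interval of length O(`β ^ (-(n
k + h * n (k + 1)))`). Counting the cylinders of order `n (k + 1)` that meet it gives the increment
of `freeDigits`, up to a factor linear in `n (k + 1)`. -/
theorem exists_ncard_branchVal_nearReturnSet_le {β : ℝ} (hβ : 1 < β) :
    ∃ C : ℝ, 1 ≤ C ∧ ∀ (h : ℝ) (n : ℕ → ℕ), Monotone n → 1 ≤ n 0 → ∀ k,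
      ((branchVal β (n k) '' nearReturnSet β h n k).ncard : ℝ) ≤
        (C * (n k + 1)) ^ (k + 1) * β ^ freeDigits h n k := by
  have hb : 0 < β - 1 := by linarith
  have hβ0 : 0 < β := by linarith
  set c := 2 * β / (β - 1) with hc
  have hc0 : 0 < c := by positivity
  refine ⟨β / (β - 1) * (2 * c) + β / (β - 1) + 3, ?_, ?_⟩
  · have : 0 < β / (β - 1) * (2 * c) + β / (β - 1) := by positivity
    linarith
  intro h n hn hn0 k
  set C := β / (β - 1) * (2 * c) + β / (β - 1) + 3 with hC
  have hd0 : 0 < β / (β - 1) := by positivity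
  have hC3 : 3 + β / (β - 1) ≤ C := by
    have : 0 < β / (β - 1) * (2 * c) := by positivity
    linarith
  have hC4 : 3 + β / (β - 1) * (2 * c) ≤ C := by linarith
  induction k with
  | zero =>
    have h1 := ncard_branchVal_image_le hβ (n 0) (J := nearReturnSet β h n 0) (u := 0) (ℓ := 1)
      zero_le_one (nearReturnSet_subset_Ico _ _ _ _)
      ((nearReturnSet_subset_Ico _ _ _ _).trans (by
        rw [zero_add]; exact Set.Ico_subset_Icc_self))
    rw [freeDigits, Real.rpow_natCast]
    have hp : 1 ≤ β ^ n 0 := one_le_pow₀ hβ.le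
    have hm : (0 : ℝ) ≤ n 0 := Nat.cast_nonneg _
    rw [mul_one] at h1
    calc _ ≤ _ := h1
      _ ≤ β / (β - 1) * ((n 0 + 1) * β ^ n 0) + 3 * ((n 0 + 1) * β ^ n 0) := by
        gcongr
        · nlinarith
        · nlinarith
      _ = (3 + β / (β - 1)) * ((n 0 + 1) * β ^ n 0) := by ring
      _ ≤ C * ((n 0 + 1) * β ^ n 0) := by gcongr
      _ = _ := by ring
  | succ k ih =>
    have hnk : 1 ≤ n k := hn0.trans (hn (Nat.zero_le k))
    have hsub0 := nearReturnSet_subset_Ico β h n k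
    have hfin := finite_branchVal_image β (n k) hsub0
    set F := hfin.toFinset with hF
    set P : ℝ → Set ℝ := fun a => {x | x ∈ nearReturnSet β h n (k + 1) ∧ branchVal β (n k) x = a}
      with hP
    have hcov : branchVal β (n (k + 1)) '' nearReturnSet β h n (k + 1) ⊆
        ⋃ a ∈ F, branchVal β (n (k + 1)) '' P a := by
      rintro _ ⟨x, hx, rfl⟩
      refine Set.mem_biUnion (x := branchVal β (n k) x) ?_ ⟨x, ⟨hx, rfl⟩, rfl⟩
      simp only [hF, Set.Finite.coe_toFinset]
      exact ⟨x, nearReturnSet_anti _ _ _ _ hx, rfl⟩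
    have hPI : ∀ a, P a ⊆ Set.Ico (0 : ℝ) 1 := fun a x hx => hx.1.1
    set M := max ((1 - h) * n (k + 1) - n k) 0 with hM
    have hm : (0 : ℝ) ≤ n (k + 1) := Nat.cast_nonneg _
    have hβM : 1 ≤ β ^ M := Real.one_le_rpow hβ.le (le_max_right _ _)
    have hpiece : ∀ a ∈ F, ((branchVal β (n (k + 1)) '' P a).ncard : ℝ) ≤
        C * (n (k + 1) + 1) * β ^ M := by
      intro a _
      rcases (P a).eq_empty_or_nonempty with he | ⟨x0, hx0⟩
      · rw [he, Set.image_empty, Set.ncard_empty]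
        have : 0 ≤ C := by linarith
        simp only [Nat.cast_zero]
        positivity
      set ℓ := c * β ^ (-(n k + h * n (k + 1))) with hℓ
      have hℓ0 : 0 < ℓ := by positivity
      have hPs : P a ⊆ Set.Icc (x0 - ℓ) (x0 - ℓ + 2 * ℓ) := by
        intro x hx
        have := abs_sub_le_of_mem_nearReturnSet hβ hnk hx.1 hx0.1 (hx.2.trans hx0.2.symm)
        rw [← hc, ← hℓ, abs_le] at this
        exact ⟨by linarith, by linarith⟩
      have h1 := ncard_branchVal_image_le hβ (n (k + 1)) (by positivity) (hPI a) hPs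
      have h2 : β ^ n (k + 1) * (2 * ℓ) ≤ 2 * c * β ^ M := by
        have : β ^ n (k + 1) * (2 * ℓ) = 2 * c * β ^ ((1 - h) * n (k + 1) - n k) := by
          have e : (1 - h) * n (k + 1) - n k = (n (k + 1) : ℝ) + (-(n k + h * n (k + 1))) := by ring
          rw [hℓ, e, Real.rpow_add hβ0, Real.rpow_natCast]; ring
        rw [this]
        gcongr
        · exact hβ.le
        · exact le_max_left _ _
      calc _ ≤ _ := h1
        _ ≤ β / (β - 1) * (2 * c * ((n (k + 1) + 1) * β ^ M)) + 3 * ((n (k + 1) + 1) * β ^ M) := by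
          have h3 : (n (k + 1) : ℝ) + 1 ≤ (n (k + 1) + 1) * β ^ M :=
            le_mul_of_one_le_right (by linarith) hβM
          have h4 : β ^ n (k + 1) * (2 * ℓ) ≤ 2 * c * ((n (k + 1) + 1) * β ^ M) := by
            refine h2.trans (mul_le_mul_of_nonneg_left ?_ (by positivity))
            exact le_mul_of_one_le_left (by positivity) (by linarith)
          exact add_le_add (mul_le_mul_of_nonneg_left h4 hd0.le)
            (mul_le_mul_of_nonneg_left h3 (by norm_num))
        _ = (3 + β / (β - 1) * (2 * c)) * ((n (k + 1) + 1) * β ^ M) := by ring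
        _ ≤ C * ((n (k + 1) + 1) * β ^ M) := by gcongr
        _ = _ := by ring
    have hsum : (branchVal β (n (k + 1)) '' nearReturnSet β h n (k + 1)).ncard ≤
        ∑ a ∈ F, (branchVal β (n (k + 1)) '' P a).ncard := by
      refine (Set.ncard_le_ncard hcov ?_).trans (Finset.set_ncard_biUnion_le _ _)
      exact F.finite_toSet.biUnion fun a _ => finite_branchVal_image β _ (hPI a)
    have hC0 : 0 < C := by linarith
    calc ((branchVal β (n (k + 1)) '' nearReturnSet β h n (k + 1)).ncard : ℝ)
        ≤ ∑ a ∈ F, ((branchVal β (n (k + 1)) '' P a).ncard : ℝ) := by exact_mod_cast hsum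
      _ ≤ ∑ a ∈ F, C * (n (k + 1) + 1) * β ^ M := Finset.sum_le_sum hpiece
      _ = (branchVal β (n k) '' nearReturnSet β h n k).ncard * (C * (n (k + 1) + 1) * β ^ M) := by
        rw [Finset.sum_const, nsmul_eq_mul, Set.ncard_eq_toFinset_card _ hfin]
      _ ≤ ((C * (n k + 1)) ^ (k + 1) * β ^ freeDigits h n k) * (C * (n (k + 1) + 1) * β ^ M) := by
        gcongr
      _ ≤ ((C * (n (k + 1) + 1)) ^ (k + 1) * β ^ freeDigits h n k) *
            (C * (n (k + 1) + 1) * β ^ M) := by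
        have : (n k : ℝ) ≤ n (k + 1) := by exact_mod_cast hn (Nat.le_succ k)
        gcongr
      _ = _ := by
        rw [freeDigits, ← hM, Real.rpow_add hβ0]; ring

/-! ### Covers and Hausdorff measure -/

/-- Borel–Cantelli for the outer measure at each scale `r`: the limsup of the `U N` is null at every
scale, so its Hausdorff measure vanishes. -/
theorem dimH_le_of_frequently_mem {E : Set ℝ} {U : ℕ → Set ℝ} {d : NNReal} {c : ℕ → ℝ}
    (hc : Summable c)
    (hU : ∀ r : ℝ≥0∞, 0 < r → ∀ᶠ N in atTop,
      OuterMeasure.mkMetric'.pre (fun s : Set ℝ => Metric.ediam s ^ (d : ℝ)) r (U N) ≤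
        ENNReal.ofReal (c N))
    (hE : ∀ x ∈ E, ∃ᶠ N in atTop, x ∈ U N) : dimH E ≤ d := by
  refine dimH_le_of_hausdorffMeasure_ne_top (d := d) ?_
  suffices h : Measure.hausdorffMeasure (d : ℝ) E = 0 by simp [h]
  have h0 : ∀ r : ℝ≥0∞, 0 < r →
      OuterMeasure.mkMetric'.pre (fun s : Set ℝ => Metric.ediam s ^ (d : ℝ)) r E = 0 := by
    intro r hr
    obtain ⟨M, hM⟩ := eventually_atTop.1 (hU r hr)
    set μ := OuterMeasure.mkMetric'.pre (fun s : Set ℝ => Metric.ediam s ^ (d : ℝ)) r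
    have hs : ∑' N, μ (U (N + M)) ≠ ∞ := by
      have hc' : Summable fun N => c (N + M) := (summable_nat_add_iff M).2 hc
      refine ne_top_of_le_ne_top ?_ (ENNReal.tsum_le_tsum fun N => hM (N + M) (by omega))
      exact hc'.tsum_ofReal_ne_top
    refine measure_mono_null ?_ (measure_limsup_atTop_eq_zero hs)
    intro x hx
    rw [Filter.mem_limsup_iff_frequently_mem]
    have := hE x hx
    rw [Filter.frequently_atTop] at this ⊢
    intro a
    obtain ⟨b, hb, hxb⟩ := this (a + M)
    exact ⟨b - M, by omega, by rwa [Nat.sub_add_cancel (by omega)]⟩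
  rw [Measure.hausdorffMeasure, ← Measure.toOuterMeasure_apply, Measure.mkMetric_toOuterMeasure,
    OuterMeasure.mkMetric, OuterMeasure.mkMetric']
  simp only [OuterMeasure.iSup_apply, ENNReal.iSup_eq_zero]
  exact fun r hr => h0 r hr

/-- Outer measure of the cover of `nearReturnSet` by pieces of cylinders of order `n k`. -/
theorem pre_nearReturnSet_le {β h : ℝ} (hβ : 1 < β) {n : ℕ → ℕ} {k : ℕ} (hn : 1 ≤ n k)
    {d : NNReal} {r : ℝ≥0∞}
    (hr : ENNReal.ofReal (2 * β / (β - 1) * β ^ (-(n k + h * n (k + 1)))) ≤ r) :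
    OuterMeasure.mkMetric'.pre (fun s : Set ℝ => Metric.ediam s ^ (d : ℝ)) r
        (nearReturnSet β h n (k + 1)) ≤
      ENNReal.ofReal ((branchVal β (n k) '' nearReturnSet β h n k).ncard *
        (2 * β / (β - 1) * β ^ (-(n k + h * n (k + 1)))) ^ (d : ℝ)) := by
  set μ := OuterMeasure.mkMetric'.pre (fun s : Set ℝ => Metric.ediam s ^ (d : ℝ)) r with hμ
  have hb : 0 < β - 1 := by linarith
  have hβ0 : 0 < β := by linarith
  set ℓ := 2 * β / (β - 1) * β ^ (-(n k + h * n (k + 1))) with hℓ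
  have hℓ0 : 0 < ℓ := by positivity
  have hfin := finite_branchVal_image β (n k) (nearReturnSet_subset_Ico β h n k)
  set F := hfin.toFinset with hF
  set P : ℝ → Set ℝ := fun a => {x | x ∈ nearReturnSet β h n (k + 1) ∧ branchVal β (n k) x = a}
    with hP
  have hcov : nearReturnSet β h n (k + 1) ⊆ ⋃ a ∈ F, P a := by
    intro x hx
    refine Set.mem_biUnion (x := branchVal β (n k) x) ?_ ⟨hx, rfl⟩
    simp only [hF, Set.Finite.coe_toFinset]
    exact ⟨x, nearReturnSet_anti _ _ _ _ hx, rfl⟩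
  have hdiam : ∀ a, Metric.ediam (P a) ≤ ENNReal.ofReal ℓ := by
    intro a
    refine Metric.ediam_le fun x hx y hy => ?_
    rw [edist_dist, Real.dist_eq]
    exact ENNReal.ofReal_le_ofReal
      (abs_sub_le_of_mem_nearReturnSet hβ hn hx.1 hy.1 (hx.2.trans hy.2.symm))
  have hpiece : ∀ a ∈ F, μ (P a) ≤ ENNReal.ofReal (ℓ ^ (d : ℝ)) := by
    intro a _
    refine (OuterMeasure.mkMetric'.pre_le ((hdiam a).trans hr)).trans ?_
    rw [← ENNReal.ofReal_rpow_of_pos hℓ0]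
    exact ENNReal.rpow_le_rpow (hdiam a) d.2
  calc _ ≤ μ (⋃ a ∈ F, P a) := measure_mono hcov
    _ ≤ ∑ a ∈ F, μ (P a) := measure_biUnion_finset_le _ _
    _ ≤ ∑ a ∈ F, ENNReal.ofReal (ℓ ^ (d : ℝ)) := Finset.sum_le_sum hpiece
    _ = _ := by
      rw [Finset.sum_const, nsmul_eq_mul, Set.ncard_eq_toFinset_card _ hfin,
        ENNReal.ofReal_mul (by positivity), ENNReal.ofReal_natCast]

/-- With `k = O(log N)` the left side is `exp (O((log N)^2))`. It absorbs both the choices of times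
and the polynomial factors of the cylinder counts. -/
theorem eventually_subexponential_le (A C c : ℝ) (hA : 0 ≤ A) (hC : 1 ≤ C) {η : ℝ} (hη : 0 < η) :
    ∀ᶠ N : ℕ in atTop, ∀ k : ℕ, (k : ℝ) ≤ A * Real.log N + 1 →
      c * ((k + 1) * (C * (N + 1) ^ 2) ^ (k + 2)) ≤ Real.exp (η * N) := by
  have hcast : Tendsto (fun N : ℕ => (N : ℝ)) atTop atTop := tendsto_natCast_atTop_atTop
  have hlog : Tendsto (fun N : ℕ => Real.log N) atTop atTop := Real.tendsto_log_atTop.comp hcast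
  have h1 : ∀ᶠ N : ℕ in atTop, (4 * (A + 1) + 1) * Real.log N ^ 2 ≤ η * N := by
    have hlo := (Real.isLittleO_pow_log_id_atTop (n := 2)).comp_tendsto hcast
    have := hlo.def (c := η / (4 * (A + 1) + 1)) (by positivity)
    filter_upwards [this] with N hN
    simp only [Function.comp, id, Real.norm_eq_abs] at hN
    rw [abs_of_nonneg (by positivity), abs_of_nonneg (Nat.cast_nonneg N), div_mul_eq_mul_div,
      le_div_iff₀ (by positivity)] at hN
    linarith
  have h2 : ∀ᶠ N : ℕ in atTop, 4 * (2 * C) ≤ (N : ℝ) := hcast.eventually_ge_atTop _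
  have h3 : ∀ᶠ N : ℕ in atTop, max c 3 ≤ Real.log N := hlog.eventually_ge_atTop _
  filter_upwards [h1, h2, h3] with N h1 h2 h3 k hk
  have hN1 : (1 : ℝ) ≤ N := by linarith
  have hN0 : (0 : ℝ) < N := by linarith
  have hl3 : 3 ≤ Real.log N := (le_max_right _ _).trans h3
  have hlc : c ≤ Real.log N := (le_max_left _ _).trans h3
  have hbase : 2 * C * (N + 1) ^ 2 ≤ (N : ℝ) ^ 4 := by
    have : (N + 1 : ℝ) ^ 2 ≤ 4 * (N : ℝ) ^ 2 := by nlinarith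
    calc 2 * C * (N + 1) ^ 2 ≤ 2 * C * (4 * (N : ℝ) ^ 2) := by gcongr
      _ = 4 * (2 * C) * (N : ℝ) ^ 2 := by ring
      _ ≤ N * (N : ℝ) ^ 2 := by gcongr
      _ ≤ N * N * (N : ℝ) ^ 2 := by
        have : (0 : ℝ) ≤ (N : ℝ) ^ 2 := by positivity
        nlinarith
      _ = _ := by ring
  have hk2 : ((k + 1 : ℕ) : ℝ) ≤ 2 ^ (k + 2) := by
    have : k + 1 < 2 ^ (k + 1) := Nat.lt_two_pow_self
    have h' : k + 1 ≤ 2 ^ (k + 2) := this.le.trans (Nat.pow_le_pow_right (by norm_num) (by omega))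
    exact_mod_cast h'
  have hbase0 : 0 ≤ C * ((N : ℝ) + 1) ^ 2 := by positivity
  have hX : ((k : ℝ) + 1) * (C * (N + 1) ^ 2) ^ (k + 2) ≤
      Real.exp (4 * (A + 1) * Real.log N ^ 2) := by
    calc ((k : ℝ) + 1) * (C * (N + 1) ^ 2) ^ (k + 2)
        ≤ 2 ^ (k + 2) * (C * (N + 1) ^ 2) ^ (k + 2) := by
          push_cast at hk2; gcongr
      _ = (2 * C * (N + 1) ^ 2) ^ (k + 2) := by rw [← mul_pow]; ring
      _ ≤ ((N : ℝ) ^ 4) ^ (k + 2) := by gcongr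
      _ = Real.exp ((4 * (k + 2)) * Real.log N) := by
        rw [← pow_mul, ← Real.rpow_natCast, Real.rpow_def_of_pos hN0]; push_cast; ring_nf
      _ ≤ Real.exp (4 * (A + 1) * Real.log N ^ 2) := by
        apply Real.exp_le_exp.2
        have : (k : ℝ) + 2 ≤ (A + 1) * Real.log N := by linarith
        nlinarith
  have hX0 : 0 ≤ ((k : ℝ) + 1) * (C * (N + 1) ^ 2) ^ (k + 2) := by positivity
  calc c * (((k : ℝ) + 1) * (C * (N + 1) ^ 2) ^ (k + 2))
      ≤ Real.exp (Real.log N ^ 2) * Real.exp (4 * (A + 1) * Real.log N ^ 2) := by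
        have : c ≤ Real.exp (Real.log N ^ 2) := by
          have := Real.add_one_le_exp (Real.log N ^ 2)
          nlinarith
        exact mul_le_mul this hX hX0 (Real.exp_pos _).le
    _ = Real.exp ((4 * (A + 1) + 1) * Real.log N ^ 2) := by rw [← Real.exp_add]; ring_nf
    _ ≤ _ := Real.exp_le_exp.2 h1

theorem le_log_of_geometric_growth {n : ℕ → ℕ} {r : ℝ} (hr : 1 < r) (hmono : Monotone n)
    (h0 : 1 ≤ n 0) (hgrow : ∀ k, r * n k ≤ n (k + 2)) (k : ℕ) :
    (k : ℝ) ≤ 2 / Real.log r * Real.log (n (k + 1)) + 1 := by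
  have hlr : 0 < Real.log r := Real.log_pos hr
  have hpow : ∀ j : ℕ, r ^ j ≤ n (2 * j) := by
    intro j
    induction j with
    | zero => simpa using h0
    | succ j ih =>
      have := hgrow (2 * j)
      rw [pow_succ', mul_add, mul_one]
      exact (mul_le_mul_of_nonneg_left ih (by linarith)).trans this
  set j := (k + 1) / 2 with hj
  have h1 : r ^ j ≤ n (k + 1) := (hpow j).trans (by exact_mod_cast hmono (by omega))
  have h2 : j * Real.log r ≤ Real.log (n (k + 1)) := by
    rw [← Real.log_pow]; exact Real.log_le_log (by positivity) h1
  have h3 : (k : ℝ) ≤ 2 * j := by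
    have : k ≤ 2 * j := by omega
    exact_mod_cast this
  have h4 : (j : ℝ) ≤ Real.log (n (k + 1)) / Real.log r := by rwa [le_div_iff₀ hlr]
  have h5 : 2 / Real.log r * Real.log (n (k + 1)) = 2 * (Real.log (n (k + 1)) / Real.log r) := by
    ring
  rw [h5]; linarith

/-- The union of all `nearReturnSet`s with at most `K + 2` prescribed times, the last one being `N`,
and few free digits. -/
def nearReturnCover (β h θ : ℝ) (K N : ℕ) : Set ℝ :=
  ⋃ k ∈ Finset.range (K + 1), ⋃ p : Fin (k + 2) → Fin (N + 1),
    {x | ∃ q : ℕ → ℕ, q = (fun i => (p ⟨min i (k + 1), by omega⟩ : ℕ)) ∧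
      Monotone q ∧ 1 ≤ q 0 ∧ q (k + 1) = N ∧ freeDigits h q k ≤ θ * (q k + h * N) ∧
      x ∈ nearReturnSet β h q (k + 1)}

/-- At most `(N + 1) ^ (k + 2)` tuples of times are possible. For each one, the free digit condition
bounds the pieces by a power `θ * L` of `β`, against sizes of power `-L` raised to `d`; since `L ≥ h
* N`, the gain is at least `(d - θ) * (h * N)`. -/
theorem pre_nearReturnCover_le {β h θ : ℝ} (hβ : 1 < β) {d : NNReal} (hd : θ < d)
    {C : ℝ} (hC1 : 1 ≤ C)
    (hC : ∀ (h : ℝ) (n : ℕ → ℕ), Monotone n → 1 ≤ n 0 → ∀ k,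
      ((branchVal β (n k) '' nearReturnSet β h n k).ncard : ℝ) ≤
        (C * (n k + 1)) ^ (k + 1) * β ^ freeDigits h n k)
    (K N : ℕ) {r : ℝ≥0∞} (hr : ENNReal.ofReal (2 * β / (β - 1) * β ^ (-(h * N))) ≤ r) :
    OuterMeasure.mkMetric'.pre (fun s : Set ℝ => Metric.ediam s ^ (d : ℝ)) r
        (nearReturnCover β h θ K N) ≤
      ENNReal.ofReal ((K + 1) * ((C * (N + 1) ^ 2) ^ (K + 2) * ((2 * β / (β - 1)) ^ (d : ℝ) *
        β ^ (-((d - θ) * (h * N)))))) := by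
  set μ := OuterMeasure.mkMetric'.pre (fun s : Set ℝ => Metric.ediam s ^ (d : ℝ)) r with hμ
  have hb : 0 < β - 1 := by linarith
  have hβ0 : 0 < β := by linarith
  set c := 2 * β / (β - 1) with hc
  have hc0 : 0 < c := by positivity
  set X := c ^ (d : ℝ) * β ^ (-((d - θ) * (h * N))) with hX
  have hX0 : 0 < X := by positivity
  have hpiece : ∀ k : ℕ, ∀ p : Fin (k + 2) → Fin (N + 1),
      μ {x | ∃ q : ℕ → ℕ, q = (fun i => (p ⟨min i (k + 1), by omega⟩ : ℕ)) ∧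
      Monotone q ∧ 1 ≤ q 0 ∧ q (k + 1) = N ∧ freeDigits h q k ≤ θ * (q k + h * N) ∧
      x ∈ nearReturnSet β h q (k + 1)} ≤ ENNReal.ofReal ((C * (N + 1)) ^ (k + 1) * X) := by
    intro k p
    set q : ℕ → ℕ := fun i => (p ⟨min i (k + 1), by omega⟩ : ℕ) with hq
    by_cases hgood : Monotone q ∧ 1 ≤ q 0 ∧ q (k + 1) = N ∧ freeDigits h q k ≤ θ * (q k + h * N)
    swap
    · refine le_trans (measure_mono (t := ∅) ?_) (by simp)
      rintro x ⟨_, rfl, h1, h2, h3, h4, -⟩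
      exact hgood ⟨h1, h2, h3, h4⟩
    obtain ⟨h1, h2, h3, h4⟩ := hgood
    have hqN : (q k : ℝ) ≤ N := by rw [← h3]; exact_mod_cast h1 (Nat.le_succ k)
    refine (measure_mono (t := nearReturnSet β h q (k + 1)) ?_).trans
      ((pre_nearReturnSet_le hβ (h2.trans (h1 (Nat.zero_le k))) ?_).trans
        (ENNReal.ofReal_le_ofReal ?_))
    · rintro x ⟨_, rfl, -, -, -, -, hx⟩
      exact hx
    · refine le_trans (ENNReal.ofReal_le_ofReal ?_) hr
      rw [h3]
      refine mul_le_mul_of_nonneg_left ?_ hc0.le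
      refine Real.rpow_le_rpow_of_exponent_le hβ.le ?_
      have : (0 : ℝ) ≤ q k := Nat.cast_nonneg _
      linarith
    · rw [h3, ← hc]
      set L : ℝ := q k + h * N with hL
      have hLN : h * N ≤ L := by
        have : (0 : ℝ) ≤ q k := Nat.cast_nonneg _
        linarith
      have e1 : (c * β ^ (-L)) ^ (d : ℝ) = c ^ (d : ℝ) * β ^ (-(d * L)) := by
        rw [Real.mul_rpow hc0.le (by positivity), ← Real.rpow_mul hβ0.le]; ring_nf
      rw [e1]
      calc _ ≤ ((C * (q k + 1)) ^ (k + 1) * β ^ freeDigits h q k) *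
              (c ^ (d : ℝ) * β ^ (-(d * L))) := by
            gcongr; exact hC h q h1 h2 k
        _ ≤ ((C * (N + 1)) ^ (k + 1) * β ^ (θ * L)) * (c ^ (d : ℝ) * β ^ (-(d * L))) := by
            gcongr
            exact hβ.le
        _ = (C * (N + 1)) ^ (k + 1) * (c ^ (d : ℝ) * β ^ (-((d - θ) * L))) := by
            have : -((d - θ) * L) = θ * L + -(d * L) := by ring
            rw [this, Real.rpow_add hβ0]; ring
        _ ≤ _ := by
            rw [hX]
            have : -((d - θ) * L) ≤ -((d - θ) * (h * N)) := by
              have := mul_le_mul_of_nonneg_left hLN (sub_nonneg.2 hd.le)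
              linarith
            have h5 := Real.rpow_le_rpow_of_exponent_le hβ.le this
            gcongr
  have hC0 : 0 < C := by linarith
  have hN1 : (1 : ℝ) ≤ N + 1 := by
    have : (0 : ℝ) ≤ N := Nat.cast_nonneg _
    linarith
  have hk : ∀ k ∈ Finset.range (K + 1), μ (⋃ p : Fin (k + 2) → Fin (N + 1),
      {x | ∃ q : ℕ → ℕ, q = (fun i => (p ⟨min i (k + 1), by omega⟩ : ℕ)) ∧
      Monotone q ∧ 1 ≤ q 0 ∧ q (k + 1) = N ∧ freeDigits h q k ≤ θ * (q k + h * N) ∧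
      x ∈ nearReturnSet β h q (k + 1)}) ≤ ENNReal.ofReal ((C * (N + 1) ^ 2) ^ (K + 2) * X) := by
    intro k hk
    have hkK : k ≤ K := by have := Finset.mem_range.1 hk; omega
    calc _ ≤ ∑ p : Fin (k + 2) → Fin (N + 1), μ _ := measure_iUnion_fintype_le _ _
      _ ≤ ∑ p : Fin (k + 2) → Fin (N + 1), ENNReal.ofReal ((C * (N + 1)) ^ (k + 1) * X) :=
          Finset.sum_le_sum fun p _ => hpiece k p
      _ = ENNReal.ofReal ((N + 1) ^ (k + 2) * ((C * (N + 1)) ^ (k + 1) * X)) := by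
          rw [Finset.sum_const, Finset.card_univ, Fintype.card_fun, Fintype.card_fin,
            Fintype.card_fin, nsmul_eq_mul, ENNReal.ofReal_mul (p := ((N : ℝ) + 1) ^ (k + 2))
            (by positivity), ← ENNReal.ofReal_natCast]
          push_cast; rfl
      _ ≤ _ := by
          apply ENNReal.ofReal_le_ofReal
          rw [← mul_assoc]
          refine mul_le_mul_of_nonneg_right ?_ hX0.le
          calc ((N : ℝ) + 1) ^ (k + 2) * (C * (N + 1)) ^ (k + 1)
              ≤ ((N : ℝ) + 1) ^ (k + 2) * (C * (N + 1)) ^ (k + 2) := by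
                refine mul_le_mul_of_nonneg_left ?_ (by positivity)
                exact pow_le_pow_right₀ (by nlinarith) (by omega)
            _ = (C * (N + 1) ^ 2) ^ (k + 2) := by rw [← mul_pow]; ring
            _ ≤ _ := pow_le_pow_right₀ (by nlinarith) (by omega)
  calc _ ≤ ∑ k ∈ Finset.range (K + 1), μ _ := measure_biUnion_finset_le _ _
    _ ≤ ∑ k ∈ Finset.range (K + 1), ENNReal.ofReal ((C * (N + 1) ^ 2) ^ (K + 2) * X) :=
        Finset.sum_le_sum hk
    _ = _ := by
        rw [Finset.sum_const, Finset.card_range, nsmul_eq_mul,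
          ENNReal.ofReal_mul (p := (K : ℝ) + 1) (by positivity), ← ENNReal.ofReal_natCast]
        push_cast; rfl

theorem dimH_nearReturn_le {β h θ r : ℝ} (hβ : 1 < β) (hh : 0 < h) (hr : 1 < r) :
    dimH {x : ℝ | x ∈ Set.Ico (0 : ℝ) 1 ∧ ∃ n : ℕ → ℕ, StrictMono n ∧ 1 ≤ n 0 ∧
      (∀ k, r * n k ≤ n (k + 2)) ∧
      (∀ k, |(betaMap β)^[n k] x - x| ≤ β ^ (-(h * n (k + 1)))) ∧
      ∃ᶠ k in atTop, freeDigits h n k ≤ θ * (n k + h * n (k + 1))} ≤ ENNReal.ofReal θ := by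
  refine le_of_forall_gt_imp_ge_of_dense fun a ha => ?_
  obtain ⟨d, hd, hda⟩ := ENNReal.lt_iff_exists_nnreal_btwn.1 ha
  refine le_trans ?_ hda.le
  have hθd : θ < d := by
    by_contra! hle
    have := ENNReal.ofReal_le_ofReal hle
    rw [ENNReal.ofReal_coe_nnreal] at this
    exact absurd hd (not_lt.2 this)
  obtain ⟨C, hC1, hC⟩ := exists_ncard_branchVal_nearReturnSet_le hβ
  have hβ0 : 0 < β := by linarith
  have hlr : 0 < Real.log r := Real.log_pos hr
  have hlβ : 0 < Real.log β := Real.log_pos hβ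
  set A := 2 / Real.log r with hA
  have hA0 : 0 < A := by positivity
  set K : ℕ → ℕ := fun N => ⌊A * Real.log N + 1⌋₊ with hK
  -- The cover has decay rate `η`: half is spent on the subexponential factor, the other half makes
  -- the series converge.
  set η := (d - θ) * h * Real.log β with hη
  have hη0 : 0 < η := mul_pos (mul_pos (sub_pos.2 hθd) hh) hlβ
  refine dimH_le_of_frequently_mem (U := fun N => nearReturnCover β h θ (K N) N)
    (c := fun N => Real.exp (-(η / 2)) ^ N) ?_ ?_ ?_
  · exact summable_geometric_of_lt_one (Real.exp_pos _).le (by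
      rw [← Real.exp_zero]; exact Real.exp_lt_exp.2 (by linarith))
  · intro ρ hρ
    have hcast : Tendsto (fun N : ℕ => (N : ℝ)) atTop atTop := tendsto_natCast_atTop_atTop
    have hsmall : ∀ᶠ N : ℕ in atTop,
        ENNReal.ofReal (2 * β / (β - 1) * β ^ (-(h * (N : ℝ)))) ≤ ρ := by
      have h1 : Tendsto (fun N : ℕ => 2 * β / (β - 1) * β ^ (-(h * (N : ℝ)))) atTop (𝓝 0) := by
        rw [← mul_zero (2 * β / (β - 1))]
        refine Tendsto.const_mul _ ?_
        have h2 : Tendsto (fun N : ℕ => -(h * (N : ℝ))) atTop atBot :=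
          tendsto_neg_atTop_atBot.comp (hcast.const_mul_atTop hh)
        exact (tendsto_rpow_atBot_of_base_gt_one β hβ).comp h2
      have h2 := ENNReal.tendsto_ofReal h1
      rw [ENNReal.ofReal_zero] at h2
      exact h2.eventually (eventually_le_nhds hρ)
    filter_upwards [hsmall, eventually_subexponential_le A C ((2 * β / (β - 1)) ^ (d : ℝ))
      hA0.le hC1 (half_pos hη0)] with N h1 h2
    refine (pre_nearReturnCover_le hβ hθd hC1 hC (K N) N h1).trans
      (ENNReal.ofReal_le_ofReal ?_)
    have h3 := h2 (K N) (Nat.floor_le (by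
      have := Real.log_natCast_nonneg N; positivity))
    have e1 : β ^ (-((d - θ) * (h * (N : ℝ)))) = Real.exp (-(η * N)) := by
      rw [Real.rpow_def_of_pos hβ0, hη]; ring_nf
    have e2 : Real.exp (-(η / 2)) ^ N = Real.exp (η / 2 * N) * Real.exp (-(η * N)) := by
      rw [← Real.exp_nat_mul, ← Real.exp_add]; ring_nf
    rw [e1, e2]
    calc _ = (2 * β / (β - 1)) ^ (d : ℝ) * (((K N : ℝ) + 1) * (C * (N + 1) ^ 2) ^ (K N + 2)) *
          Real.exp (-(η * N)) := by ring
      _ ≤ _ := by gcongr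
  · rintro x ⟨hx, n, hmono, hn0, hgrow, hret, hfreq⟩
    have htend : Tendsto (fun k => n (k + 1)) atTop atTop :=
      hmono.tendsto_atTop.comp (tendsto_add_atTop_nat 1)
    refine htend.frequently (hfreq.mono fun k hk => ?_)
    have hkK : k ≤ K (n (k + 1)) :=
      Nat.le_floor (le_log_of_geometric_growth hr hmono.monotone hn0 hgrow k)
    refine Set.mem_biUnion (x := k) (Finset.mem_coe.2 (Finset.mem_range.2 (by omega))) ?_
    -- Only the times up to index `k + 1` enter the conditions, so the sequence may be frozen from
    -- there on.
    refine Set.mem_iUnion.2 ⟨fun i => ⟨n i, Nat.lt_succ_of_le (hmono.monotone (by omega))⟩, ?_⟩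
    refine ⟨fun i => n (min i (k + 1)), rfl, ?_, ?_, ?_, ?_, hx, ?_⟩
    · intro i j hij
      exact hmono.monotone (min_le_min_right _ hij)
    · simpa using hn0
    · simp
    · rw [freeDigits_congr h (m := n) (fun i hi => by rw [min_eq_left (by omega)])]
      simpa using hk
    · intro i hi
      have e1 : min i (k + 1) = i := min_eq_left (by omega)
      have e2 : min (i + 1) (k + 1) = i + 1 := min_eq_left (by omega)
      simp only [e1, e2]
      exact hret i

/-! ### Extraction of near-return times and the upper bounds -/

theorem freeDigits_nonneg (h : ℝ) (n : ℕ → ℕ) (k : ℕ) : 0 ≤ freeDigits h n k := by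
  induction k with
  | zero => exact Nat.cast_nonneg _
  | succ k ih => exact add_nonneg ih (le_max_right _ _)

/-- With `a`, `b` consecutive times and `F`, `F'` the successive values of `freeDigits`, division by
`a * b` turns this into a drop of `F / a - F' / b` by at least `(θ - d) * (1 - a / b)`. -/
theorem freeDigits_succ_mul_le {h θ a b F : ℝ} (hh : 0 < h) (hθ : ((1 - h) / (1 + h)) ^ 2 < θ)
    (ha : 0 < a) (hab : a < b) (hF : θ * (a + h * b) < F) :
    (θ - ((1 - h) / (1 + h)) ^ 2) * (b - a) * a ≤ F * b - (F + max ((1 - h) * b - a) 0) * a := by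
  set d := ((1 - h) / (1 + h)) ^ 2 with hd
  have hd0 : 0 ≤ d := by positivity
  have hba : 0 < b - a := by linarith
  have hb : 0 < b := by linarith
  have hFba : θ * (a + h * b) * (b - a) ≤ F * (b - a) := mul_le_mul_of_nonneg_right hF.le hba.le
  rcases le_total ((1 - h) * b - a) 0 with hc | hc
  · rw [max_eq_right hc]
    have h1 : 0 ≤ d * (a + h * b) * (b - a) := by positivity
    have h2 : 0 ≤ (θ - d) * (h * b) * (b - a) :=
      mul_nonneg (mul_nonneg (sub_pos.2 hθ).le (by positivity)) hba.le
    linarith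
  · rw [max_eq_left hc]
    -- The value of `d` is what makes this a perfect square. It vanishes at `b / a = 2 / (1 - h)`,
    -- the ratio used for the lower bound.
    have h1 : d * (a + h * b) * (b - a) - (1 - h) * a * b + a ^ 2 =
        h / (1 + h) ^ 2 * ((1 - h) * b - 2 * a) ^ 2 := by
      rw [hd]; field_simp; ring
    have h3 : 0 ≤ h / (1 + h) ^ 2 * ((1 - h) * b - 2 * a) ^ 2 := by positivity
    have h2 : 0 ≤ (θ - d) * (h * b) * (b - a) :=
      mul_nonneg (mul_nonneg (sub_pos.2 hθ).le (by positivity)) hba.le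
    linarith

theorem frequently_freeDigits_le {h θ r : ℝ} (hh : 0 < h) (hθ : ((1 - h) / (1 + h)) ^ 2 < θ)
    (hr : 1 < r) {n : ℕ → ℕ} (hmono : StrictMono n) (hn0 : 1 ≤ n 0)
    (hgrow : ∀ k, r * n k ≤ n (k + 2)) :
    ∃ᶠ k in atTop, freeDigits h n k ≤ θ * (n k + h * n (k + 1)) := by
  intro hcon
  obtain ⟨K, hK⟩ := eventually_atTop.1 hcon
  set d := ((1 - h) / (1 + h)) ^ 2 with hd
  have hpos : ∀ k, (0 : ℝ) < n k := fun k => by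
    exact_mod_cast hn0.trans (hmono.monotone (Nat.zero_le k))
  have hlt : ∀ k, (n k : ℝ) < n (k + 1) := fun k => by exact_mod_cast hmono (Nat.lt_succ_self k)
  have hcd : 0 < θ - d := sub_pos.2 hθ
  have hstep : ∀ k ≥ K, (θ - d) * (1 - n k / n (k + 1)) ≤
      freeDigits h n k / n k - freeDigits h n (k + 1) / n (k + 1) := by
    intro k hk
    have h1 := freeDigits_succ_mul_le hh hθ (hpos k) (hlt k) (not_le.1 (hK k hk))
    have ha := hpos k
    have hb := hpos (k + 1)
    have e1 : (θ - d) * (1 - (n k : ℝ) / n (k + 1)) =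
        (θ - d) * (n (k + 1) - n k) * n k / (n k * n (k + 1)) := by field_simp
    have e2 : freeDigits h n k / n k - freeDigits h n (k + 1) / n (k + 1) =
        (freeDigits h n k * n (k + 1) - freeDigits h n (k + 1) * n k) / (n k * n (k + 1)) := by
      field_simp
    rw [e1, e2]
    exact div_le_div_of_nonneg_right h1 (by positivity)
  have htwo : ∀ k ≥ K, freeDigits h n (k + 2) / n (k + 2) ≤
      freeDigits h n k / n k - (θ - d) * (1 - 1 / r) := by
    intro k hk
    have h1 := hstep k hk
    have h2 := hstep (k + 1) (by omega)
    set p : ℝ := n k / n (k + 1) with hp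
    set q : ℝ := n (k + 1) / n (k + 1 + 1) with hq
    have hp1 : p ≤ 1 := (div_le_one (hpos _)).2 (hlt k).le
    have hq1 : q ≤ 1 := (div_le_one (hpos _)).2 (hlt (k + 1)).le
    have hpq : p * q ≤ 1 / r := by
      have e : p * q = n k / n (k + 2) := by
        have := (hpos (k + 1)).ne'
        rw [hp, hq]; field_simp
      rw [e, div_le_div_iff₀ (hpos _) (by linarith)]
      linarith [hgrow k]
    -- From `(1 - p) * (1 - q) ≥ 0`. Growth is known over two steps only, so two successive drops
    -- are combined.
    have h3 : 1 - 1 / r ≤ (1 - p) + (1 - q) := by nlinarith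
    have h4 := mul_le_mul_of_nonneg_left h3 hcd.le
    rw [mul_add] at h4
    linarith
  have hδ : 0 < (θ - d) * (1 - 1 / r) := by
    refine mul_pos hcd (sub_pos.2 ?_)
    rw [div_lt_one (by linarith)]; exact hr
  have hiter : ∀ m : ℕ, freeDigits h n (K + 2 * m) / n (K + 2 * m) ≤
      freeDigits h n K / n K - m * ((θ - d) * (1 - 1 / r)) := by
    intro m
    induction m with
    | zero => simp
    | succ m ih =>
      have := htwo (K + 2 * m) (by omega)
      rw [mul_add, mul_one, ← add_assoc]
      push_cast
      linarith
  obtain ⟨m, hm⟩ := exists_nat_gt (freeDigits h n K / n K / ((θ - d) * (1 - 1 / r)))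
  rw [div_lt_iff₀ hδ] at hm
  have h1 := hiter m
  have h2 : 0 ≤ freeDigits h n (K + 2 * m) / n (K + 2 * m) :=
    div_nonneg (freeDigits_nonneg _ _ _) (hpos _).le
  linarith

/-- Let `n` minimize the displacement over `[1, N]` and let `R` be the first time that beats it. The
uniform condition at `R - 1` gives `D n < β ^ (-h' * (R - 1))`. The next minimizer is taken over the
larger window `[1, ⌈r * R⌉]`, which forces geometric growth; the gap between `h` and `h'` pays for
the enlargement. -/
theorem exists_nearReturn_times {β h h' x : ℝ} (hβ : 1 < β) (hh : 0 < h) (hh' : h < h')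
    (hper : ∀ n, 1 ≤ n → (betaMap β)^[n] x ≠ x)
    (hev : ∀ᶠ N : ℕ in atTop, ∃ n : ℕ, 1 ≤ n ∧ n ≤ N ∧
      |(betaMap β)^[n] x - x| < β ^ (-(h' * N))) :
    ∃ n : ℕ → ℕ, StrictMono n ∧ 1 ≤ n 0 ∧ (∀ k, (1 + h' / h) / 2 * n k ≤ n (k + 2)) ∧
      ∀ k, |(betaMap β)^[n k] x - x| ≤ β ^ (-(h * n (k + 1))) := by
  set D : ℕ → ℝ := fun n => |(betaMap β)^[n] x - x| with hD
  have hDpos : ∀ n, 1 ≤ n → 0 < D n := fun n hn => abs_pos.2 (sub_ne_zero.2 (hper n hn))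
  have hh'0 : 0 < h' := hh.trans hh'
  obtain ⟨N₁, hN₁⟩ := eventually_atTop.1 hev
  -- This threshold on `R` is equivalent to `h * (r * R + 1) ≤ h' * (R - 1)`, since `h * r = (h +
  -- h') / 2`.
  obtain ⟨N₂, hN₂⟩ := exists_nat_ge (2 * (h + h') / (h' - h))
  set N₀ := max (max N₁ N₂) 1 with hN₀
  set r := (1 + h' / h) / 2 with hr
  have hr1 : 1 < r := by
    have : 1 < h' / h := (one_lt_div hh).2 hh'
    rw [hr]; linarith
  have hhr : h * r = (h + h') / 2 := by rw [hr]; field_simp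
  have hargmin : ∀ N, 1 ≤ N → ∃ n, 1 ≤ n ∧ n ≤ N ∧ ∀ j, 1 ≤ j → j ≤ N → D n ≤ D j := by
    intro N hN
    obtain ⟨n, hn, hmin⟩ := Finset.exists_min_image (Finset.Icc 1 N) D ⟨1, by simp [hN]⟩
    rw [Finset.mem_Icc] at hn
    exact ⟨n, hn.1, hn.2, fun j h1 h2 => hmin j (Finset.mem_Icc.2 ⟨h1, h2⟩)⟩
  have hsmall : ∀ δ > 0, ∃ n, 1 ≤ n ∧ D n < δ := by
    intro δ hδ
    have h1 : Tendsto (fun N : ℕ => β ^ (-(h' * (N : ℝ)))) atTop (𝓝 0) :=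
      (tendsto_rpow_atBot_of_base_gt_one β hβ).comp
        (tendsto_neg_atTop_atBot.comp (tendsto_natCast_atTop_atTop.const_mul_atTop hh'0))
    obtain ⟨N, ⟨n, hn1, -, hn⟩, hN⟩ := (hev.and (h1.eventually (eventually_lt_nhds hδ))).exists
    exact ⟨n, hn1, hn.trans hN⟩
  let S := {p : ℕ × ℕ // 1 ≤ p.1 ∧ p.1 ≤ p.2 ∧ N₀ ≤ p.2 ∧ ∀ j, 1 ≤ j → j ≤ p.2 → D p.1 ≤ D j}
  have hstep : ∀ s : S, ∃ s' : S, s.1.2 < s'.1.1 ∧ r * s.1.2 ≤ s'.1.2 ∧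
      D s.1.1 ≤ β ^ (-(h * s'.1.2)) := by
    rintro ⟨⟨n, N⟩, hn1, hnN, hN0, hmin⟩
    dsimp only at hn1 hnN hN0 hmin ⊢
    classical
    have hex : ∃ m, 1 ≤ m ∧ D m < D n := hsmall _ (hDpos n hn1)
    set R := Nat.find hex with hR
    obtain ⟨hR1, hRD⟩ := Nat.find_spec hex
    rw [← hR] at hR1 hRD
    have hRmin : ∀ m, 1 ≤ m → D m < D n → R ≤ m := fun m h1 h2 => Nat.find_min' hex ⟨h1, h2⟩
    have hNR : N < R := by
      by_contra! hle
      exact absurd hRD (not_lt.2 (hmin R hR1 hle))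
    obtain ⟨j, hj1, hjR, hj⟩ := hN₁ (R - 1) (by omega)
    have hDn : D n ≤ D j := by
      by_contra! hlt
      have := hRmin j hj1 hlt
      omega
    have hRr : (R : ℝ) ≤ r * R := le_mul_of_one_le_left (Nat.cast_nonneg _) hr1.le
    have hRc : R ≤ ⌈r * R⌉₊ := by exact_mod_cast hRr.trans (Nat.le_ceil _)
    obtain ⟨n', hn'1, hn'N, hmin'⟩ := hargmin ⌈r * R⌉₊ (hR1.trans hRc)
    refine ⟨⟨(n', ⌈r * R⌉₊), hn'1, hn'N, by dsimp only; omega, hmin'⟩, ?_, ?_, ?_⟩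
    · dsimp only
      exact hNR.trans_le (hRmin n' hn'1 ((hmin' R hR1 hRc).trans_lt hRD))
    · dsimp only
      refine le_trans ?_ (Nat.le_ceil _)
      have : (N : ℝ) ≤ R := by exact_mod_cast hNR.le
      exact mul_le_mul_of_nonneg_left this (by linarith)
    · dsimp only
      refine hDn.trans (hj.le.trans (Real.rpow_le_rpow_of_exponent_le hβ.le (neg_le_neg ?_)))
      have h1 : (⌈r * R⌉₊ : ℝ) < r * R + 1 := Nat.ceil_lt_add_one (by positivity)
      have h2 : ((R - 1 : ℕ) : ℝ) = R - 1 := by push_cast [Nat.cast_sub hR1]; ring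
      have h3 : 2 * (h + h') / (h' - h) ≤ R := by
        refine hN₂.trans ?_
        exact_mod_cast (show N₂ ≤ R by omega)
      rw [div_le_iff₀ (by linarith)] at h3
      rw [h2]
      have h4 : h * (⌈r * R⌉₊ : ℝ) ≤ h * (r * R + 1) := mul_le_mul_of_nonneg_left h1.le hh.le
      have h5 : h * (r * R + 1) = (h + h') / 2 * R + h := by rw [← hhr]; ring
      linarith
  choose f hf using hstep
  obtain ⟨n₀, hn₀1, hn₀N, hn₀min⟩ := hargmin N₀ (le_max_right _ _)
  let s₀ : S := ⟨(n₀, N₀), hn₀1, hn₀N, le_rfl, hn₀min⟩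
  set s : ℕ → S := fun k => f^[k] s₀ with hs
  have hsucc : ∀ k, s (k + 1) = f (s k) := fun k => Function.iterate_succ_apply' f k s₀
  have hA : ∀ k, (s k).1.2 < (s (k + 1)).1.1 := fun k => by rw [hsucc]; exact (hf (s k)).1
  have hB : ∀ k, r * (s k).1.2 ≤ (s (k + 1)).1.2 := fun k => by rw [hsucc]; exact (hf (s k)).2.1
  have hC : ∀ k, D (s k).1.1 ≤ β ^ (-(h * (s (k + 1)).1.2)) := fun k => by
    rw [hsucc]; exact (hf (s k)).2.2
  refine ⟨fun k => (s k).1.1, strictMono_nat_of_lt_succ fun k => (s k).2.2.1.trans_lt (hA k),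
    (s 0).2.1, fun k => ?_, fun k => ?_⟩
  · have h1 : ((s (k + 1)).1.2 : ℝ) ≤ (s (k + 2)).1.1 := by exact_mod_cast (hA (k + 1)).le
    have h2 : ((s k).1.1 : ℝ) ≤ (s k).1.2 := by exact_mod_cast (s k).2.2.1
    have h3 : r * (s k).1.1 ≤ r * (s k).1.2 := mul_le_mul_of_nonneg_left h2 (by linarith)
    exact h3.trans ((hB k).trans h1)
  · refine (hC k).trans (Real.rpow_le_rpow_of_exponent_le hβ.le (neg_le_neg ?_))
    have : ((s (k + 1)).1.1 : ℝ) ≤ (s (k + 1)).1.2 := by exact_mod_cast (s (k + 1)).2.2.1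
    exact mul_le_mul_of_nonneg_left this hh.le

theorem countable_periodic {β : ℝ} (hβ : 1 < β) :
    {x : ℝ | x ∈ Set.Ico (0 : ℝ) 1 ∧ ∃ n, 1 ≤ n ∧ (betaMap β)^[n] x = x}.Countable := by
  have : {x : ℝ | x ∈ Set.Ico (0 : ℝ) 1 ∧ ∃ n, 1 ≤ n ∧ (betaMap β)^[n] x = x} ⊆
      ⋃ n : ℕ, (fun a => a / (β ^ n - 1)) '' (branchVal β n '' Set.Ico 0 1) := by
    rintro x ⟨hx, n, hn, hxn⟩
    refine Set.mem_iUnion.2 ⟨n, _, ⟨x, hx, rfl⟩, ?_⟩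
    have : 1 < β ^ n := one_lt_pow₀ hβ (by omega)
    simp only [branchVal, hxn]
    rw [div_eq_iff (by linarith)]; ring
  refine Set.Countable.mono this (Set.countable_iUnion fun n => ?_)
  exact ((finite_branchVal_image β n le_rfl).image _).countable

theorem pow_rpow_neg {β : ℝ} (hβ : 1 < β) (N : ℕ) (s : ℝ) :
    (β ^ N) ^ (-s) = β ^ (-(s * N)) := by
  rw [← Real.rpow_natCast, ← Real.rpow_mul (by linarith)]; ring_nf

theorem eventually_of_lt_uniformRecExp {β h x : ℝ} (hβ : 1 < β)
    (hx : ENNReal.ofReal h < uniformRecExp β x) :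
    ∀ᶠ N : ℕ in atTop, ∃ n : ℕ, 1 ≤ n ∧ n ≤ N ∧ |(betaMap β)^[n] x - x| < β ^ (-(h * N)) := by
  rw [uniformRecExp, lt_sSup_iff] at hx
  obtain ⟨_, ⟨s, ⟨hs0, hs⟩, rfl⟩, hlt⟩ := hx
  have hhs : h ≤ s := by
    by_contra! hle
    exact absurd hlt (not_lt.2 (ENNReal.ofReal_le_ofReal hle.le))
  filter_upwards [hs] with N ⟨n, h1, h2, h3⟩
  refine ⟨n, h1, h2, h3.trans_le ?_⟩
  rw [pow_rpow_neg hβ]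
  exact Real.rpow_le_rpow_of_exponent_le hβ.le
    (neg_le_neg (mul_le_mul_of_nonneg_right hhs (Nat.cast_nonneg _)))

/-- The bound is continuous at `s`, so `h < h' < s` close to `s` leaves room for the extraction of
times. Periodic points, to which it does not apply, are countable. -/
theorem dimH_le_uniformRecExp_le {β s : ℝ} (hβ : 1 < β) (hs : 0 < s) :
    dimH {x : ℝ | x ∈ Set.Ico (0 : ℝ) 1 ∧ ENNReal.ofReal s ≤ uniformRecExp β x} ≤
      ENNReal.ofReal (((1 - s) / (1 + s)) ^ 2) := by
  refine le_of_forall_gt_imp_ge_of_dense fun a ha => ?_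
  obtain ⟨θ, hθ, hθa⟩ := ENNReal.lt_iff_exists_nnreal_btwn.1 ha
  refine le_trans ?_ hθa.le
  have hsθ : ((1 - s) / (1 + s)) ^ 2 < θ := by
    by_contra! hle
    have := ENNReal.ofReal_le_ofReal hle
    rw [ENNReal.ofReal_coe_nnreal] at this
    exact absurd hθ (not_lt.2 this)
  obtain ⟨h, ⟨hh0, hhs⟩, hhθ⟩ : ∃ h, (0 < h ∧ h < s) ∧ ((1 - h) / (1 + h)) ^ 2 < θ := by
    have hcont : ContinuousAt (fun h : ℝ => ((1 - h) / (1 + h)) ^ 2) s := by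
      refine ContinuousAt.pow (ContinuousAt.div (by fun_prop) (by fun_prop) (by linarith)) 2
    have h1 : ∀ᶠ h in 𝓝[<] s, ((1 - h) / (1 + h)) ^ 2 < (θ : ℝ) :=
      (hcont.eventually (eventually_lt_nhds hsθ)).filter_mono nhdsWithin_le_nhds
    have h2 : ∀ᶠ h in 𝓝[<] s, 0 < h ∧ h < s := Ioo_mem_nhdsLT hs
    exact (h2.and h1).exists
  set h' := (h + s) / 2 with hh'
  have hr : 1 < (1 + h' / h) / 2 := by
    have : 1 < h' / h := (one_lt_div hh0).2 (by linarith)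
    linarith
  have hsub : {x : ℝ | x ∈ Set.Ico (0 : ℝ) 1 ∧ ENNReal.ofReal s ≤ uniformRecExp β x} ⊆
      {x : ℝ | x ∈ Set.Ico (0 : ℝ) 1 ∧ ∃ n, 1 ≤ n ∧ (betaMap β)^[n] x = x} ∪
      {x : ℝ | x ∈ Set.Ico (0 : ℝ) 1 ∧ ∃ n : ℕ → ℕ, StrictMono n ∧ 1 ≤ n 0 ∧
      (∀ k, (1 + h' / h) / 2 * n k ≤ n (k + 2)) ∧
      (∀ k, |(betaMap β)^[n k] x - x| ≤ β ^ (-(h * n (k + 1)))) ∧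
      ∃ᶠ k in atTop, freeDigits h n k ≤ θ * (n k + h * n (k + 1))} := by
    rintro x ⟨hx, hxs⟩
    by_cases hper : ∃ n, 1 ≤ n ∧ (betaMap β)^[n] x = x
    · exact Or.inl ⟨hx, hper⟩
    push Not at hper
    have hlt : ENNReal.ofReal h' < uniformRecExp β x :=
      lt_of_lt_of_le ((ENNReal.ofReal_lt_ofReal_iff hs).2 (by linarith)) hxs
    obtain ⟨n, h1, h2, h3, h4⟩ := exists_nearReturn_times hβ hh0 (by linarith) hper
      (eventually_of_lt_uniformRecExp hβ hlt)
    exact Or.inr ⟨hx, n, h1, h2, h3, h4, frequently_freeDigits_le hh0 hhθ hr h1 h2 h3⟩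
  refine (dimH_mono hsub).trans ?_
  rw [dimH_union, (countable_periodic hβ).dimH_zero]
  refine max_le zero_le ?_
  have := dimH_nearReturn_le (θ := θ) hβ hh0 hr
  rwa [ENNReal.ofReal_coe_nnreal] at this

/-- No digit is free after some index, so `freeDigits` is eventually constant while `n k` tends to
infinity. -/
theorem frequently_freeDigits_le_of_mul_le {h θ : ℝ} (hh : 0 < h) (hθ : 0 < θ) {n : ℕ → ℕ}
    (hmono : StrictMono n) (hdead : ∀ᶠ k in atTop, (1 - h) * n (k + 1) ≤ n k) :
    ∃ᶠ k in atTop, freeDigits h n k ≤ θ * (n k + h * n (k + 1)) := by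
  obtain ⟨K, hK⟩ := eventually_atTop.1 hdead
  have hconst : ∀ k ≥ K, freeDigits h n k = freeDigits h n K := by
    intro k hk
    induction k, hk using Nat.le_induction with
    | base => rfl
    | succ k hk ih =>
      rw [freeDigits, ih, max_eq_right (by linarith [hK k hk]), add_zero]
  have h1 : ∀ᶠ k in atTop, freeDigits h n K / θ ≤ (n k : ℝ) :=
    (tendsto_natCast_atTop_atTop.comp hmono.tendsto_atTop).eventually_ge_atTop _
  refine Eventually.frequently ?_
  filter_upwards [h1, eventually_ge_atTop K] with k hk hkK
  rw [hconst k hkK]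
  rw [div_le_iff₀ hθ] at hk
  have : 0 ≤ θ * (h * n (k + 1)) := by positivity
  linarith

/-- The condition `ρ < a / (1 - a)` restates `ρ / (1 + ρ) < a`; rational values keep the later union
countable. -/
theorem exists_rat_of_ratioOneAdd_lt {ρ σ : ℝ≥0∞} (hρ : ρ ≠ ⊤) (h : ratioOneAdd ρ < σ) :
    ∃ a b : ℚ, 0 < (a : ℝ) ∧ (a : ℝ) < b ∧ (a : ℝ) < 1 ∧ ENNReal.ofReal b < σ ∧
      ρ < ENNReal.ofReal (a / (1 - a)) := by
  rw [ratioOneAdd, if_neg hρ] at h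
  lift ρ to NNReal using hρ
  have e : (ρ : ℝ≥0∞) / (1 + ρ) = ENNReal.ofReal (ρ / (1 + ρ)) := by
    rw [ENNReal.ofReal_div_of_pos (by positivity), ENNReal.ofReal_add zero_le_one ρ.coe_nonneg,
      ENNReal.ofReal_one, ENNReal.ofReal_coe_nnreal]
  have hlt : ENNReal.ofReal ((ρ : ℝ) / (1 + ρ)) < min σ 1 := by
    refine lt_min (e ▸ h) ?_
    rw [← ENNReal.ofReal_one, ENNReal.ofReal_lt_ofReal_iff one_pos, div_lt_one (by positivity)]
    linarith
  have h0 : (0 : ℝ) ≤ ρ / (1 + ρ) := by positivity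
  obtain ⟨c, hc1, hc2⟩ := ENNReal.lt_iff_exists_nnreal_btwn.1 hlt
  have hc1' : (ρ : ℝ) / (1 + ρ) < c := by
    rw [← ENNReal.ofReal_coe_nnreal] at hc1
    exact (ENNReal.ofReal_lt_ofReal_iff_of_nonneg h0).1 hc1
  have hc3 : (c : ℝ) < 1 := by exact_mod_cast hc2.trans_le (min_le_right _ _)
  obtain ⟨b, hb1, hb2⟩ := exists_rat_btwn hc1'
  obtain ⟨a, ha1, ha2⟩ := exists_rat_btwn hb1
  refine ⟨a, b, h0.trans_lt ha1, ha2, by linarith, ?_, ?_⟩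
  · refine lt_of_lt_of_le ?_ (hc2.le.trans (min_le_left _ _))
    rw [← ENNReal.ofReal_coe_nnreal]
    exact (ENNReal.ofReal_lt_ofReal_iff_of_nonneg (by linarith)).2 hb2
  · have ha3 : (a : ℝ) < 1 := by linarith
    rw [← ENNReal.ofReal_coe_nnreal]
    refine (ENNReal.ofReal_lt_ofReal_iff_of_nonneg ρ.coe_nonneg).2 ?_
    rw [lt_div_iff₀ (by linarith)]
    rw [div_lt_iff₀ (by positivity)] at ha1
    have : (0 : ℝ) ≤ ρ := ρ.coe_nonneg
    linarith

theorem eventually_le_of_recExp_lt {β R x : ℝ} (hβ : 1 < β) (hR : 0 ≤ R)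
    (hx : recExp β x < ENNReal.ofReal R) :
    ∀ᶠ n : ℕ in atTop, β ^ (-(R * n)) ≤ |(betaMap β)^[n] x - x| := by
  have hfin : {n : ℕ | 1 ≤ n ∧ |(betaMap β)^[n] x - x| < (β ^ n) ^ (-R)}.Finite := by
    by_contra hinf
    exact absurd hx (not_lt.2 (le_sSup ⟨R, ⟨hR, hinf⟩, rfl⟩))
  have := hfin.eventually_cofinite_notMem
  rw [Nat.cofinite_eq_atTop] at this
  filter_upwards [this, eventually_ge_atTop 1] with n hn hn1
  rw [← pow_rpow_neg hβ]
  by_contra! hlt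
  exact hn ⟨hn1, hlt⟩

theorem dimH_ratioOneAdd_recExp_lt_uniformRecExp {β : ℝ} (hβ : 1 < β) :
    dimH {x : ℝ | x ∈ Set.Ico (0 : ℝ) 1 ∧ ratioOneAdd (recExp β x) < uniformRecExp β x} = 0 := by
  refine le_antisymm (le_of_forall_gt_imp_ge_of_dense fun a ha => ?_) zero_le
  obtain ⟨θ, hθ, hθa⟩ := ENNReal.lt_iff_exists_nnreal_btwn.1 ha
  refine le_trans ?_ hθa.le
  have hθ0 : 0 < (θ : ℝ) := by exact_mod_cast hθ
  set Z : ℚ × ℚ → Set ℝ := fun p =>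
    {x : ℝ | (0 < (p.1 : ℝ) ∧ (p.1 : ℝ) < p.2) ∧ x ∈ Set.Ico (0 : ℝ) 1 ∧
      ∃ n : ℕ → ℕ, StrictMono n ∧ 1 ≤ n 0 ∧
      (∀ k, (1 + (p.2 : ℝ) / p.1) / 2 * n k ≤ n (k + 2)) ∧
      (∀ k, |(betaMap β)^[n k] x - x| ≤ β ^ (-(p.1 * n (k + 1) : ℝ))) ∧
      ∃ᶠ k in atTop, freeDigits p.1 n k ≤ θ * (n k + p.1 * n (k + 1))} with hZ
  have hsub : {x : ℝ | x ∈ Set.Ico (0 : ℝ) 1 ∧ ratioOneAdd (recExp β x) < uniformRecExp β x} ⊆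
      {x : ℝ | x ∈ Set.Ico (0 : ℝ) 1 ∧ ∃ n, 1 ≤ n ∧ (betaMap β)^[n] x = x} ∪
      {x : ℝ | x ∈ Set.Ico (0 : ℝ) 1 ∧ ENNReal.ofReal 1 ≤ uniformRecExp β x} ∪ ⋃ p, Z p := by
    rintro x ⟨hx, hlt⟩
    by_cases hper : ∃ n, 1 ≤ n ∧ (betaMap β)^[n] x = x
    · exact Or.inl (Or.inl ⟨hx, hper⟩)
    push Not at hper
    by_cases htop : recExp β x = ⊤
    · rw [ratioOneAdd, if_pos htop] at hlt
      exact Or.inl (Or.inr ⟨hx, by rw [ENNReal.ofReal_one]; exact hlt.le⟩)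
    obtain ⟨p, q, hp0, hpq, hp1, hqσ, hρ⟩ := exists_rat_of_ratioOneAdd_lt htop hlt
    obtain ⟨n, h1, h2, h3, h4⟩ := exists_nearReturn_times hβ hp0 hpq hper
      (eventually_of_lt_uniformRecExp hβ hqσ)
    refine Or.inr (Set.mem_iUnion.2 ⟨(p, q), ⟨hp0, hpq⟩, hx, n, h1, h2, h3, h4, ?_⟩)
    refine frequently_freeDigits_le_of_mul_le hp0 hθ0 h1 ?_
    have hp1' : 0 < 1 - (p : ℝ) := by linarith
    have hev := h1.tendsto_atTop.eventually
      -- Comparing this lower bound on the displacement with the upper bound `β ^ (-(p * n (k +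
      -- 1)))` yields `(1 - p) * n (k + 1) ≤ n k`.
      (eventually_le_of_recExp_lt hβ (div_nonneg hp0.le hp1'.le) hρ)
    filter_upwards [hev] with k hk
    have h5 := (Real.rpow_le_rpow_left_iff hβ).1 (hk.trans (h4 k))
    have h6 : (p : ℝ) * n (k + 1) ≤ p / (1 - p) * n k := by linarith
    have h7 : (p : ℝ) / (1 - p) * n k = p * (n k / (1 - p)) := by ring
    rw [h7] at h6
    have h8 := le_of_mul_le_mul_left h6 hp0
    rw [le_div_iff₀ hp1'] at h8
    linarith
  refine (dimH_mono hsub).trans ?_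
  rw [dimH_union, dimH_union, dimH_iUnion, (countable_periodic hβ).dimH_zero]
  refine max_le (max_le zero_le ?_) (iSup_le fun p => ?_)
  · refine (dimH_le_uniformRecExp_le hβ one_pos).trans ?_
    simp
  · by_cases hp : 0 < (p.1 : ℝ) ∧ (p.1 : ℝ) < p.2
    · have hr : 1 < (1 + (p.2 : ℝ) / p.1) / 2 := by
        have : 1 < (p.2 : ℝ) / p.1 := (one_lt_div hp.1).2 hp.2
        linarith
      have := dimH_nearReturn_le (θ := θ) hβ hp.1 hr
      rw [ENNReal.ofReal_coe_nnreal] at this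
      exact (dimH_mono fun x hx => hx.2).trans this
    · have : Z p = ∅ := Set.eq_empty_of_forall_notMem fun x hx => hp hx.1
      rw [this, dimH_empty]
      exact zero_le

/-! ### Points with prescribed near-returns -/

/-- Half of the number of full branches of order `n`. -/
noncomputable def halfFullCount (β : ℝ) (n : ℕ) : ℕ := (fullBranches β n (Set.Ico 0 1)).ncard / 2

/-- Keeping every second full branch leaves a gap of one unit between kept cylinders, and one to the
right of the last. -/
theorem exists_separated_fullBranches {β : ℝ} (hβ : 1 < β) (n : ℕ) :
    ∃ c : ℕ → ℝ, (∀ e < halfFullCount β n, IsFullBranch β n (c e) ∧ c e + 2 ≤ β ^ n) ∧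
      ∀ e e', e < e' → e' < halfFullCount β n → c e + 2 * (e' - e) ≤ c e' := by
  have hfin := finite_fullBranches β n (J := Set.Ico 0 1) le_rfl
  set s := hfin.toFinset with hs
  have hcard : (fullBranches β n (Set.Ico 0 1)).ncard = s.card :=
    Set.ncard_eq_toFinset_card _ hfin
  set g := s.orderEmbOfFin rfl with hg
  have hgfull : ∀ i, IsFullBranch β n (g i) := by
    intro i
    have : g i ∈ s := s.orderEmbOfFin_mem rfl i
    exact (hfin.mem_toFinset.1 this).2
  set G : ℕ → ℝ := fun i => if h : i < s.card then g ⟨i, h⟩ else 0 with hG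
  have hGe : ∀ i (h : i < s.card), G i = g ⟨i, h⟩ := fun i h => dif_pos h
  have hstep : ∀ i, i + 1 < s.card → G i + 1 ≤ G (i + 1) := by
    intro i hi
    rw [hGe i (by omega), hGe (i + 1) hi]
    refine (hgfull _).add_one_le' hβ (hgfull _) (g.strictMono ?_)
    simp
  have hdiff : ∀ i d : ℕ, i + d < s.card → G i + d ≤ G (i + d) := by
    intro i d
    induction d with
    | zero => simp
    | succ d ih =>
      intro h
      have h1 := ih (by omega)
      have h2 := hstep (i + d) (by omega)
      rw [← add_assoc]; push_cast; linarith
  refine ⟨fun e => G (2 * e), fun e he => ?_, fun e e' hee he' => ?_⟩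
  · have he2 : 2 * e + 1 < s.card := by rw [halfFullCount, hcard] at he; omega
    dsimp only
    refine ⟨by rw [hGe _ (by omega)]; exact hgfull _, ?_⟩
    have h1 := hstep _ he2
    have h2 := (hgfull ⟨2 * e + 1, he2⟩).add_one_le_pow hβ
    rw [← hGe] at h2
    linarith
  · have he2 : 2 * e' < s.card := by rw [halfFullCount, hcard] at he'; omega
    obtain ⟨d, rfl⟩ := Nat.exists_eq_add_of_lt hee
    have := hdiff (2 * e) (2 * (d + 1)) (by omega)
    dsimp only
    have e1 : 2 * (e + d + 1) = 2 * e + 2 * (d + 1) := by ring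
    rw [e1]
    push_cast at this ⊢
    linarith

/-- Inside a full cylinder of order `n` there is a full cylinder all of whose points return close to
themselves at time `n`. -/
theorem IsFullBranch.exists_nearReturn {β : ℝ} (hβ : 1 < β) {n m j : ℕ} (hn : 1 ≤ n) {a : ℝ}
    (ha : IsFullBranch β n a) (hj : 2 * (j : ℝ) + 1 < β ^ j * (β ^ m)⁻¹) :
    ∃ b, IsFullBranch β j b ∧ ∀ x, b ≤ β ^ j * (β ^ n * x - a) → β ^ j * (β ^ n * x - a) ≤ b + 1 →
      |β ^ n * x - a - x| ≤ (β ^ m)⁻¹ := by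
  set δ := (β ^ m)⁻¹ with hδ
  have hm1 : 1 ≤ β ^ m := one_le_pow₀ hβ.le
  have hδ1 : δ ≤ 1 := inv_le_one_of_one_le₀ hm1
  have hδ0 : 0 < δ := by positivity
  have hn1 : 1 < β ^ n := one_lt_pow₀ hβ (by omega)
  have hn0 : 0 < β ^ n - 1 := by linarith
  -- The fixed point of the affine extension of the branch. It may equal 1, hence the clipped window
  -- starting at `min p (1 - δ)`.
  set p := a / (β ^ n - 1) with hp
  have hp0 : 0 ≤ p := div_nonneg (ha.nonneg hβ) hn0.le
  have hp1 : p ≤ 1 := by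
    rw [hp, div_le_one hn0]; linarith [ha.add_one_le_pow hβ]
  have hpa : β ^ n * p - a = p := by
    have : p * (β ^ n - 1) = a := div_mul_cancel₀ _ hn0.ne'
    linarith
  obtain ⟨b, hb, hb1, hb2⟩ := exists_isFullBranch_subset hβ (j := j) (u := min p (1 - δ)) (δ := δ)
    (le_min hp0 (by linarith)) (by linarith [min_le_right p (1 - δ)]) hj
  refine ⟨b, hb, fun x hx1 hx2 => ?_⟩
  have hj0 : 0 < β ^ j := by positivity
  set y := β ^ n * x - a with hy
  have hy1 : min p (1 - δ) ≤ y := le_of_mul_le_mul_left (hb1.trans hx1) hj0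
  have hy2 : y ≤ min p (1 - δ) + δ := le_of_mul_le_mul_left (hx2.trans hb2) hj0
  have hyp : |y - p| ≤ δ := by
    rw [abs_le]
    rcases min_cases p (1 - δ) with ⟨h1, h2⟩ | ⟨h1, h2⟩ <;> rw [h1] at hy1 hy2 <;>
      constructor <;> linarith
  have e : y - x = (y - p) * ((β ^ n - 1) / β ^ n) := by
    have hyp' : y - p = β ^ n * (x - p) := by linarith
    rw [hyp']
    have h1 : (β ^ n - 1) * p = a := by linarith
    field_simp
    linarith
  have hq : (β ^ n - 1) / β ^ n ≤ 1 := (div_le_one (by linarith)).2 (by linarith)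
  have hq0 : 0 ≤ (β ^ n - 1) / β ^ n := div_nonneg hn0.le (by linarith)
  rw [e, abs_mul, abs_of_nonneg hq0]
  exact (mul_le_of_le_one_right (abs_nonneg _) hq).trans hyp

/-! ### Mixed radix digits and nested full cylinders -/

theorem floor_mul_succ_eq {f : ℕ → ℕ} (hf : ∀ k, 2 ≤ f k) (t : ℝ) (k : ℕ) :
    ⌊((∏ i ∈ Finset.range (k + 1), f i : ℕ) : ℝ) * t⌋₊ =
      f k * ⌊((∏ i ∈ Finset.range k, f i : ℕ) : ℝ) * t⌋₊ +
        ⌊((∏ i ∈ Finset.range (k + 1), f i : ℕ) : ℝ) * t⌋₊ % f k := by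
  have h0 : (f k : ℝ) ≠ 0 := by have := hf k; exact_mod_cast (show f k ≠ 0 by omega)
  have h1 : ((∏ i ∈ Finset.range k, f i : ℕ) : ℝ) * t =
      ((∏ i ∈ Finset.range (k + 1), f i : ℕ) : ℝ) * t / f k := by
    rw [Finset.prod_range_succ]; push_cast; field_simp
  rw [h1, Nat.floor_div_natCast, Nat.div_add_mod]

/-- Two reals with the same integer part are separated by the first place at which their mixed radix digits
differ. -/
theorem exists_first_digit_ne {f : ℕ → ℕ} (hf : ∀ k, 2 ≤ f k) {t t' : ℝ} (ht : 0 ≤ t) (ht' : 0 ≤ t')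
    (h0 : ⌊t⌋₊ = ⌊t'⌋₊) (hne : t ≠ t') :
    ∃ k, (∀ i < k, ⌊((∏ i ∈ Finset.range (i + 1), f i : ℕ) : ℝ) * t⌋₊ % f i =
        ⌊((∏ i ∈ Finset.range (i + 1), f i : ℕ) : ℝ) * t'⌋₊ % f i) ∧
      ⌊((∏ i ∈ Finset.range (k + 1), f i : ℕ) : ℝ) * t⌋₊ % f k ≠
        ⌊((∏ i ∈ Finset.range (k + 1), f i : ℕ) : ℝ) * t'⌋₊ % f k ∧
      ((∏ i ∈ Finset.range (k + 1), f i : ℕ) : ℝ) * |t - t'| ≤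
        |((⌊((∏ i ∈ Finset.range (k + 1), f i : ℕ) : ℝ) * t⌋₊ % f k : ℕ) : ℝ) -
          (⌊((∏ i ∈ Finset.range (k + 1), f i : ℕ) : ℝ) * t'⌋₊ % f k : ℕ)| + 1 := by
  classical
  set P : ℕ → ℕ := fun k => ∏ i ∈ Finset.range k, f i with hP
  have hPs : ∀ k, P (k + 1) = P k * f k := fun k => Finset.prod_range_succ _ _
  set M : ℕ → ℝ → ℕ := fun k t => ⌊(P k : ℝ) * t⌋₊ with hM
  have hMs : ∀ k t, M (k + 1) t = f k * M k t + M (k + 1) t % f k := fun k t =>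
    floor_mul_succ_eq hf t k
  have hclose : ∀ k, ∀ d : ℝ, |(M k t : ℝ) - M k t'| = d → (P k : ℝ) * |t - t'| ≤ d + 1 := by
    rintro k d rfl
    have hPt : 0 ≤ (P k : ℝ) * t := by positivity
    have hPt' : 0 ≤ (P k : ℝ) * t' := by positivity
    have h1 := Nat.floor_le hPt
    have h2 := Nat.lt_floor_add_one ((P k : ℝ) * t)
    have h3 := Nat.floor_le hPt'
    have h4 := Nat.lt_floor_add_one ((P k : ℝ) * t')
    have e : (P k : ℝ) * |t - t'| = |(P k : ℝ) * t - P k * t'| := by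
      rw [← mul_sub, abs_mul,
        abs_of_nonneg (show (0 : ℝ) ≤ (P k : ℝ) from Nat.cast_nonneg _)]
    rw [e, abs_le]
    have h5 := neg_abs_le ((M k t : ℝ) - M k t')
    have h6 := le_abs_self ((M k t : ℝ) - M k t')
    simp only [hM] at h5 h6 ⊢
    constructor <;> linarith
  have hex : ∃ k, M (k + 1) t % f k ≠ M (k + 1) t' % f k := by
    by_contra! hall
    have hMeq : ∀ k, M k t = M k t' := by
      intro k
      induction k with
      | zero => simpa [hM, hP] using h0
      | succ k ih => rw [hMs, hMs k t', ih, hall k]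
    have hPge : ∀ k, k ≤ P k := by
      intro k
      have h1 : 2 ^ k ≤ P k := by
        induction k with
        | zero => simp [hP]
        | succ k ih => rw [hPs, pow_succ]; exact Nat.mul_le_mul ih (hf k)
      exact Nat.lt_two_pow_self.le.trans h1
    have hpos : 0 < |t - t'| := abs_pos.2 (sub_ne_zero.2 hne)
    obtain ⟨k, hk⟩ := exists_nat_gt (1 / |t - t'|)
    rw [div_lt_iff₀ hpos] at hk
    have h1 := hclose k 0 (by rw [hMeq k]; simp)
    have h2 : (k : ℝ) * |t - t'| ≤ P k * |t - t'| :=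
      mul_le_mul_of_nonneg_right (by exact_mod_cast hPge k) hpos.le
    linarith
  refine ⟨Nat.find hex, fun i hi => not_not.1 (Nat.find_min hex hi), Nat.find_spec hex, ?_⟩
  set k := Nat.find hex with hk
  have hMeq : ∀ i ≤ k, M i t = M i t' := by
    intro i
    induction i with
    | zero => intro _; simpa [hM, hP] using h0
    | succ i ih =>
      intro hi
      rw [hMs, hMs i t', ih (by omega), not_not.1 (Nat.find_min hex (show i < Nat.find hex by omega))]
  refine hclose (k + 1) _ ?_
  have e1 := hMs k t
  have e2 := hMs k t'
  rw [e1, e2, hMeq k le_rfl]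
  simp only [Nat.cast_add, add_sub_add_left_eq_sub]
  rfl

section Construction

variable (β : ℝ) (n j ℓ : ℕ → ℕ) (b : ℕ → ℝ → ℝ) (c : ℕ → ℕ → ℝ)

/-- The labels of the nested full cylinders of orders `n k` selected by the digits `e`. -/
noncomputable def nestedLabel (e : ℕ → ℕ) : ℕ → ℝ
  | 0 => 0
  | k + 1 => β ^ ℓ k * (β ^ j k * nestedLabel e k + b k (nestedLabel e k)) + c k (e k)

theorem nestedLabel_congr {e e' : ℕ → ℕ} {k : ℕ} (h : ∀ i < k, e i = e' i) :
    nestedLabel β j ℓ b c e k = nestedLabel β j ℓ b c e' k := by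
  induction k with
  | zero => rfl
  | succ k ih => rw [nestedLabel, nestedLabel, ih fun i hi => h i (by omega), h k (by omega)]

/-- The point in the intersection of the nested full cylinders selected by the digits `e`. -/
noncomputable def nestedPoint (e : ℕ → ℕ) : ℝ := ⨆ k, nestedLabel β j ℓ b c e k / β ^ n k

variable {β n j ℓ b c}

theorem nestedPoint_spec (hβ : 1 < β) (hn : ∀ k, n (k + 1) = n k + j k + ℓ k)
    (hb : ∀ k a, IsFullBranch β (n k) a → IsFullBranch β (j k) (b k a))
    {e : ℕ → ℕ} (hc : ∀ k, IsFullBranch β (ℓ k) (c k (e k)) ∧ c k (e k) + 2 ≤ β ^ ℓ k) (k : ℕ) :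
    IsFullBranch β (n k) (nestedLabel β j ℓ b c e k) ∧
    nestedLabel β j ℓ b c e k ≤ β ^ n k * nestedPoint β n j ℓ b c e ∧
    β ^ n k * nestedPoint β n j ℓ b c e < nestedLabel β j ℓ b c e k + 1 := by
  set a := nestedLabel β j ℓ b c e with ha
  have hfull : ∀ k, IsFullBranch β (n k) (a k) := by
    intro k
    induction k with
    | zero => exact isFullBranch_zero hβ _
    | succ k ih => rw [hn]; exact (ih.comp hβ (hb k _ ih)).comp hβ (hc k).1
  have hpow : ∀ k, β ^ n (k + 1) = β ^ n k * β ^ j k * β ^ ℓ k := fun k => by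
    rw [hn, pow_add, pow_add]
  have hl : ∀ k, a k / β ^ n k ≤ a (k + 1) / β ^ n (k + 1) := by
    intro k
    have h1 := (hb k _ (hfull k)).nonneg hβ
    have h2 := (hc k).1.nonneg hβ
    have e1 : a (k + 1) = β ^ ℓ k * (β ^ j k * a k + b k (a k)) + c k (e k) := rfl
    rw [e1, hpow, div_le_div_iff₀ (by positivity) (by positivity)]
    have h3 : 0 ≤ (β ^ ℓ k * b k (a k) + c k (e k)) * β ^ n k := by positivity
    linarith
  -- Strictness comes from `c + 2 ≤ β ^ ℓ` and keeps the limit point inside each half-open cylinder.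
  have hu : ∀ k, (a (k + 1) + 1) / β ^ n (k + 1) < (a k + 1) / β ^ n k := by
    intro k
    have h1 := (hb k _ (hfull k)).add_one_le_pow hβ
    have h2 := (hc k).2
    have e1 : a (k + 1) = β ^ ℓ k * (β ^ j k * a k + b k (a k)) + c k (e k) := rfl
    rw [e1, hpow, div_lt_div_iff₀ (by positivity) (by positivity)]
    have hp : 0 < β ^ n k := by positivity
    have hq : 0 < β ^ ℓ k := by positivity
    have h3 : β ^ ℓ k * (b k (a k) + 1) * β ^ n k ≤ β ^ ℓ k * β ^ j k * β ^ n k := by gcongr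
    have h4 : (c k (e k) + 1) * β ^ n k < β ^ ℓ k * β ^ n k :=
      mul_lt_mul_of_pos_right (by linarith) hp
    linarith
  have hmem := ciSup_mem_iInter_Icc_of_antitone_Icc (f := fun k => a k / β ^ n k)
    (g := fun k => (a k + 1) / β ^ n k)
    (antitone_nat_of_succ_le fun k => Set.Icc_subset_Icc (hl k) (hu k).le) (fun k => by
      have : 0 < β ^ n k := by positivity
      exact div_le_div_of_nonneg_right (by linarith) this.le)
  rw [Set.mem_iInter] at hmem
  have hp : 0 < β ^ n k := by positivity
  refine ⟨hfull k, ?_, ?_⟩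
  · have := (hmem k).1
    rw [div_le_iff₀ hp] at this
    rw [mul_comm]; exact this
  · have := (hmem (k + 1)).2.trans_lt (hu k)
    rw [lt_div_iff₀ hp] at this
    rw [mul_comm]; exact this

theorem abs_iterate_nestedPoint_sub_le (hβ : 1 < β) (hn : ∀ k, n (k + 1) = n k + j k + ℓ k)
    {m : ℕ → ℕ}
    (hb : ∀ k a, IsFullBranch β (n k) a → IsFullBranch β (j k) (b k a) ∧
      ∀ x, b k a ≤ β ^ j k * (β ^ n k * x - a) → β ^ j k * (β ^ n k * x - a) ≤ b k a + 1 →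
      |β ^ n k * x - a - x| ≤ (β ^ m k)⁻¹)
    {e : ℕ → ℕ} (hc : ∀ k, IsFullBranch β (ℓ k) (c k (e k)) ∧ c k (e k) + 2 ≤ β ^ ℓ k) (k : ℕ) :
    nestedPoint β n j ℓ b c e ∈ Set.Ico (0 : ℝ) 1 ∧
    |(betaMap β)^[n k] (nestedPoint β n j ℓ b c e) - nestedPoint β n j ℓ b c e| ≤ (β ^ m k)⁻¹ := by
  have hspec := nestedPoint_spec hβ hn (fun k a h => (hb k a h).1) hc
  obtain ⟨h1, h2, h3⟩ := hspec k
  obtain ⟨-, h4, h5⟩ := hspec (k + 1)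
  obtain ⟨hx, hT⟩ := h1.iterate_eq hβ h2 h3
  refine ⟨hx, ?_⟩
  rw [hT]
  set x := nestedPoint β n j ℓ b c e
  set a := nestedLabel β j ℓ b c e with ha
  have e1 : a (k + 1) = β ^ ℓ k * (β ^ j k * a k + b k (a k)) + c k (e k) := rfl
  have e2 : β ^ n (k + 1) = β ^ n k * β ^ j k * β ^ ℓ k := by rw [hn, pow_add, pow_add]
  have hq : 0 < β ^ ℓ k := by positivity
  rw [e1, e2] at h4 h5
  refine (hb k _ h1).2 x (le_of_mul_le_mul_left ?_ hq) (le_of_mul_le_mul_left ?_ hq)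
  · linarith [(hc k).1.nonneg hβ]
  · linarith [(hc k).2]

/-- The common prefix cancels. Labels at level `k + 1` differ by at least twice the digit
difference, and the position inside a cylinder costs at most one unit. -/
theorem le_nestedPoint_sub (hβ : 1 < β) (hn : ∀ k, n (k + 1) = n k + j k + ℓ k)
    (hb : ∀ k a, IsFullBranch β (n k) a → IsFullBranch β (j k) (b k a)) {f : ℕ → ℕ}
    (hc : ∀ k, ∀ e < f k, IsFullBranch β (ℓ k) (c k e) ∧ c k e + 2 ≤ β ^ ℓ k)
    (hsep : ∀ k e e', e < e' → e' < f k → c k e + 2 * ((e' : ℝ) - e) ≤ c k e')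
    {e e' : ℕ → ℕ} (he : ∀ k, e k < f k) (he' : ∀ k, e' k < f k) {k : ℕ}
    (heq : ∀ i < k, e i = e' i) (hlt : e k < e' k) :
    ((e' k : ℝ) - e k) / β ^ n (k + 1) ≤ nestedPoint β n j ℓ b c e' - nestedPoint β n j ℓ b c e := by
  obtain ⟨-, -, h1⟩ := nestedPoint_spec hβ hn hb (fun k => hc k _ (he k)) (k + 1)
  obtain ⟨-, h2, -⟩ := nestedPoint_spec hβ hn hb (fun k => hc k _ (he' k)) (k + 1)
  have hp : 0 < β ^ n (k + 1) := by positivity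
  rw [nestedLabel] at h1 h2
  rw [nestedLabel_congr β j ℓ b c heq] at h1
  have h3 := hsep k _ _ hlt (he' k)
  have h4 : (e k : ℝ) + 1 ≤ e' k := by exact_mod_cast hlt
  rw [div_le_iff₀ hp]
  linarith

end Construction

/-- A parametrization by `[0, 1)`, with controlled inverse, of points that return close to themselves
at prescribed times. -/
theorem exists_param_nearReturn {β : ℝ} (hβ : 1 < β) {n m j ℓ : ℕ → ℕ} (hn0 : ∀ k, 1 ≤ n k)
    (hn : ∀ k, n (k + 1) = n k + j k + ℓ k)
    (hj : ∀ k, 2 * (j k : ℝ) + 1 < β ^ j k * (β ^ m k)⁻¹)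
    (hf : ∀ k, 2 ≤ halfFullCount β (ℓ k)) :
    ∃ x : ℝ → ℝ, (∀ t k, x t ∈ Set.Ico (0 : ℝ) 1 ∧
        |(betaMap β)^[n k] (x t) - x t| ≤ (β ^ m k)⁻¹) ∧
      ∀ t ∈ Set.Ico (0 : ℝ) 1, ∀ t' ∈ Set.Ico (0 : ℝ) 1, t ≠ t' → ∃ k : ℕ, ∃ d : ℝ,
        0 < d ∧ d ≤ halfFullCount β (ℓ k) ∧
        |t - t'| ≤ 2 * d / ∏ i ∈ Finset.range (k + 1), (halfFullCount β (ℓ i) : ℝ) ∧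
        d / β ^ n (k + 1) ≤ |x t - x t'| := by
  set f : ℕ → ℕ := fun k => halfFullCount β (ℓ k) with hfdef
  have hex : ∀ k a, ∃ b, IsFullBranch β (n k) a → (IsFullBranch β (j k) b ∧
      ∀ x, b ≤ β ^ j k * (β ^ n k * x - a) → β ^ j k * (β ^ n k * x - a) ≤ b + 1 →
      |β ^ n k * x - a - x| ≤ (β ^ m k)⁻¹) := by
    intro k a
    by_cases h : IsFullBranch β (n k) a
    · obtain ⟨b, hb⟩ := h.exists_nearReturn hβ (hn0 k) (hj k)
      exact ⟨b, fun _ => hb⟩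
    · exact ⟨0, fun h' => absurd h' h⟩
  choose b hb using hex
  choose c hc hsep using fun k => exists_separated_fullBranches hβ (ℓ k)
  set P : ℕ → ℕ := fun k => ∏ i ∈ Finset.range k, f i with hP
  set e : ℝ → ℕ → ℕ := fun t k => ⌊(P (k + 1) : ℝ) * t⌋₊ % f k with he
  have hef : ∀ t k, e t k < f k := fun t k => Nat.mod_lt _ (by have := hf k; simp only [hfdef]; omega)
  refine ⟨fun t => nestedPoint β n j ℓ b c (e t), fun t k =>
    abs_iterate_nestedPoint_sub_le hβ hn hb (fun k => hc k _ (hef t k)) k, ?_⟩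
  intro t ht t' ht' hne
  obtain ⟨k, h1, h2, h3⟩ := exists_first_digit_ne hf ht.1 ht'.1
    ((Nat.floor_eq_zero.2 ht.2).trans (Nat.floor_eq_zero.2 ht'.2).symm) hne
  change e t k ≠ e t' k at h2
  change (P (k + 1) : ℝ) * |t - t'| ≤ |(e t k : ℝ) - e t' k| + 1 at h3
  have hb' : ∀ k a, IsFullBranch β (n k) a → IsFullBranch β (j k) (b k a) :=
    fun k a h => (hb k a h).1
  have hPpos : (0 : ℝ) < P (k + 1) := by
    have : 0 < P (k + 1) := Finset.prod_pos fun i _ => by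
      have := hf i; simp only [hfdef]; omega
    exact_mod_cast this
  have hd1 : (1 : ℝ) ≤ |(e t k : ℝ) - e t' k| := by
    rcases Nat.lt_or_gt_of_ne h2 with h | h
    · have : (e t k : ℝ) + 1 ≤ e t' k := by exact_mod_cast h
      rw [abs_sub_comm]; exact le_trans (by linarith) (le_abs_self _)
    · have : (e t' k : ℝ) + 1 ≤ e t k := by exact_mod_cast h
      exact le_trans (by linarith) (le_abs_self _)
  refine ⟨k, |(e t k : ℝ) - e t' k|, by linarith, ?_, ?_, ?_⟩
  · have h4 : (e t k : ℝ) ≤ f k := by exact_mod_cast (hef t k).le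
    have h5 : (e t' k : ℝ) ≤ f k := by exact_mod_cast (hef t' k).le
    have h6 : (0 : ℝ) ≤ e t k := Nat.cast_nonneg _
    have h7 : (0 : ℝ) ≤ e t' k := Nat.cast_nonneg _
    rw [abs_le]
    exact ⟨by linarith, by linarith⟩
  · have e1 : ∏ i ∈ Finset.range (k + 1), (halfFullCount β (ℓ i) : ℝ) = P (k + 1) := by
      simp only [hP, hfdef]; push_cast; rfl
    rw [e1, le_div_iff₀ hPpos]
    linarith
  · rcases Nat.lt_or_gt_of_ne h2 with h | h
    · have := le_nestedPoint_sub hβ hn hb' hc hsep (hef t) (hef t') h1 h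
      rw [abs_sub_comm, abs_sub_comm (nestedPoint β n j ℓ b c (e t))]
      rw [abs_of_nonneg (sub_nonneg.2 (Nat.cast_le.2 h.le))]
      exact this.trans (le_abs_self _)
    · have := le_nestedPoint_sub hβ hn hb' hc hsep (hef t') (hef t) (fun i hi => (h1 i hi).symm) h
      rw [abs_of_nonneg (sub_nonneg.2 (Nat.cast_le.2 h.le))]
      exact this.trans (le_abs_self _)

/-! ### Growth estimates and choice of parameters -/

theorem eventually_rpow_le_halfFullCount {β τ : ℝ} (hβ : 1 < β) (hτ0 : 0 ≤ τ) (hτ : τ < 1) :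
    ∀ᶠ n : ℕ in atTop, β ^ (τ * n) ≤ halfFullCount β n := by
  have hβ0 : 0 < β := by linarith
  have hr : 1 < β ^ (1 - τ) := Real.one_lt_rpow hβ (by linarith)
  have h1 := (tendsto_pow_const_div_const_pow_of_one_lt 1 hr).eventually
    (eventually_le_nhds (show (0 : ℝ) < 1 / 4 by norm_num))
  filter_upwards [h1, eventually_ge_atTop 1] with n h1 hn
  have hn1 : (1 : ℝ) ≤ n := by exact_mod_cast hn
  rw [pow_one, div_le_iff₀ (by positivity), ← Real.rpow_natCast, ← Real.rpow_mul hβ0.le] at h1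
  set Y := β ^ (τ * n) with hY
  have hY1 : 1 ≤ Y := Real.one_le_rpow hβ.le (by positivity)
  have e : β ^ n = β ^ ((1 - τ) * n) * Y := by
    rw [hY, ← Real.rpow_add hβ0, ← Real.rpow_natCast]; ring_nf
  have h2 : 4 * n * Y ≤ β ^ n := by
    rw [e]; exact mul_le_mul_of_nonneg_right (by linarith) (by linarith)
  have h3 := pow_sub_one_le_mul_ncard_fullBranches hβ n
  have h4 : ((fullBranches β n (Set.Ico 0 1)).ncard : ℝ) ≤ 2 * halfFullCount β n + 1 := by
    have : (fullBranches β n (Set.Ico 0 1)).ncard ≤ 2 * halfFullCount β n + 1 := by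
      unfold halfFullCount; omega
    exact_mod_cast this
  have h5 : n * (2 * Y + 1) ≤ n * (2 * (halfFullCount β n : ℝ) + 1) := by
    have h6 : n * ((fullBranches β n (Set.Ico 0 1)).ncard : ℝ) ≤
        n * (2 * (halfFullCount β n : ℝ) + 1) := mul_le_mul_of_nonneg_left h4 (by linarith)
    have h7 : (n : ℝ) ≤ n * Y := le_mul_of_one_le_right (by linarith) hY1
    linarith
  have h6 := le_of_mul_le_mul_left h5 (by linarith)
  linarith

theorem exists_bound_of_eventually_le {u : ℕ → ℝ} {M : ℝ} (h : ∀ᶠ k in atTop, u k ≤ M) :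
    ∃ B, ∀ k, u k ≤ B := by
  have : IsBoundedUnder (· ≤ ·) atTop u := ⟨M, by simpa using h⟩
  obtain ⟨B, hB⟩ := this.bddAbove_range
  exact ⟨B, fun k => hB ⟨k, rfl⟩⟩

theorem exists_rpow_le_mul_prod_halfFullCount {β ρ σ : ℝ} (hβ : 1 < β) (hρ : 1 < ρ) (hσ0 : 0 < σ)
    (hσ : σ * (ρ - 1) ^ 2 < 1) {n ℓ : ℕ → ℕ} (hntop : Tendsto n atTop atTop)
    (hn : Tendsto (fun k => (n (k + 1) : ℝ) / n k) atTop (𝓝 ρ))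
    (hℓ : Tendsto (fun k => (ℓ k : ℝ) / n k) atTop (𝓝 1))
    (hf : ∀ k, 2 ≤ halfFullCount β (ℓ k)) :
    ∃ B, ∀ k, (β ^ n (k + 1) / halfFullCount β (ℓ k)) ^ σ ≤
      B * ∏ i ∈ Finset.range k, (halfFullCount β (ℓ i) : ℝ) := by
  have hβ0 : 0 < β := by linarith
  have hρ0 : 0 < ρ - 1 := by linarith
  have hnR : Tendsto (fun k => (n k : ℝ)) atTop atTop := tendsto_natCast_atTop_atTop.comp hntop
  have hn0 : ∀ᶠ k in atTop, 0 < (n k : ℝ) := hnR.eventually_gt_atTop 0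
  have hℓtop : Tendsto ℓ atTop atTop := by
    have h1 : Tendsto (fun k => (ℓ k : ℝ) / n k * n k) atTop atTop := hℓ.pos_mul_atTop one_pos hnR
    refine tendsto_natCast_atTop_iff.1 (h1.congr' ?_)
    filter_upwards [hn0] with k hk
    exact div_mul_cancel₀ _ hk.ne'
  -- `κ` is a growth exponent for the product, `β ^ (κ * n k)` up to a constant. As `ℓ k ~ n k`,
  -- this needs `κ * (ρ - 1) < 1`, while the left side has exponent about `σ * (ρ - 1)`; the
  -- hypothesis on `σ` makes room for both.
  obtain ⟨κ, hκ1, hκ2⟩ : ∃ κ, σ * (ρ - 1) < κ ∧ κ < 1 / (ρ - 1) :=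
    exists_between (by rw [lt_div_iff₀ hρ0]; linarith)
  rw [lt_div_iff₀ hρ0] at hκ2
  obtain ⟨τ, hτ, hτ1⟩ : ∃ τ, max (max (κ * (ρ - 1)) (ρ - κ / σ)) 0 < τ ∧ τ < 1 := by
    refine exists_between (max_lt (max_lt hκ2 ?_) one_pos)
    have : ρ - 1 < κ / σ := by rw [lt_div_iff₀ hσ0]; linarith
    linarith
  have hτ0 : 0 < τ := (le_max_right _ _).trans_lt hτ
  have hτ2 : κ * (ρ - 1) < τ := ((le_max_left _ _).trans (le_max_left _ _)).trans_lt hτ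
  have hτ3 : σ * (ρ - τ) < κ := by
    have : ρ - κ / σ < τ := ((le_max_right _ _).trans (le_max_left _ _)).trans_lt hτ
    have h2 : ρ - τ < κ / σ := by linarith
    rw [lt_div_iff₀ hσ0] at h2; linarith
  have hE1 : ∀ᶠ k in atTop, κ * (n (k + 1) - n k) ≤ τ * ℓ k := by
    have hlim : Tendsto (fun k => κ * ((n (k + 1) : ℝ) / n k - 1) - τ * ((ℓ k : ℝ) / n k)) atTop
        (𝓝 (κ * (ρ - 1) - τ * 1)) := ((hn.sub_const 1).const_mul κ).sub (hℓ.const_mul τ)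
    filter_upwards [hn0, hlim.eventually (eventually_lt_nhds (show κ * (ρ - 1) - τ * 1 < 0 by
      linarith))] with k hk hlt
    have e : κ * ((n (k + 1) : ℝ) / n k - 1) - τ * ((ℓ k : ℝ) / n k) =
        (κ * (n (k + 1) - n k) - τ * ℓ k) / n k := by field_simp
    rw [e, div_lt_iff₀ hk] at hlt
    linarith
  have hE2 : ∀ᶠ k in atTop, σ * (n (k + 1) - τ * ℓ k) ≤ κ * n k := by
    have hlim : Tendsto (fun k => σ * ((n (k + 1) : ℝ) / n k - τ * ((ℓ k : ℝ) / n k))) atTop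
        (𝓝 (σ * (ρ - τ * 1))) := (hn.sub (hℓ.const_mul τ)).const_mul σ
    filter_upwards [hn0, hlim.eventually (eventually_lt_nhds (show σ * (ρ - τ * 1) < κ by
      linarith))] with k hk hlt
    have e : σ * ((n (k + 1) : ℝ) / n k - τ * ((ℓ k : ℝ) / n k)) =
        σ * (n (k + 1) - τ * ℓ k) / n k := by field_simp
    rw [e, div_lt_iff₀ hk] at hlt
    linarith
  have hE3 : ∀ᶠ k in atTop, β ^ (τ * ℓ k) ≤ (halfFullCount β (ℓ k) : ℝ) :=
    hℓtop.eventually (eventually_rpow_le_halfFullCount hβ hτ0.le hτ1)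
  have hfpos : ∀ k, (0 : ℝ) < halfFullCount β (ℓ k) := fun k => by
    have := hf k; exact_mod_cast (show 0 < halfFullCount β (ℓ k) by omega)
  set P : ℕ → ℝ := fun k => ∏ i ∈ Finset.range k, (halfFullCount β (ℓ i) : ℝ) with hP
  have hPpos : ∀ k, 0 < P k := fun k => Finset.prod_pos fun i _ => hfpos i
  obtain ⟨K, hK⟩ := eventually_atTop.1 (hE1.and (hE2.and hE3))
  have hv : ∀ k ≥ K, β ^ (κ * n k) / P k ≤ β ^ (κ * n K) / P K := by
    intro k hk
    induction k, hk using Nat.le_induction with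
    | base => exact le_rfl
    | succ k hk ih =>
      refine le_trans ?_ ih
      obtain ⟨h1, -, h3⟩ := hK k hk
      have e : P (k + 1) = P k * halfFullCount β (ℓ k) := Finset.prod_range_succ _ _
      rw [e, div_le_div_iff₀ (mul_pos (hPpos k) (hfpos k)) (hPpos k)]
      have h4 : β ^ (κ * n (k + 1)) ≤ β ^ (κ * n k) * halfFullCount β (ℓ k) := by
        have e2 : κ * n (k + 1) = κ * n k + κ * (n (k + 1) - n k) := by ring
        rw [e2, Real.rpow_add hβ0]
        exact mul_le_mul_of_nonneg_left ((Real.rpow_le_rpow_of_exponent_le hβ.le h1).trans h3)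
          (by positivity)
      have := mul_le_mul_of_nonneg_right h4 (hPpos k).le
      linarith
  obtain ⟨B, hB⟩ := exists_bound_of_eventually_le (M := β ^ (κ * n K) / P K)
    (u := fun k => (β ^ n (k + 1) / halfFullCount β (ℓ k)) ^ σ / P k) (by
      filter_upwards [eventually_ge_atTop K] with k hk
      refine le_trans (div_le_div_of_nonneg_right ?_ (hPpos k).le) (hv k hk)
      obtain ⟨-, h2, h3⟩ := hK k hk
      calc (β ^ n (k + 1) / halfFullCount β (ℓ k)) ^ σ
          ≤ (β ^ n (k + 1) / β ^ (τ * ℓ k)) ^ σ := by gcongr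
        _ = β ^ (σ * (n (k + 1) - τ * ℓ k)) := by
          rw [← Real.rpow_natCast, ← Real.rpow_sub hβ0, ← Real.rpow_mul hβ0.le, mul_comm σ]
        _ ≤ _ := Real.rpow_le_rpow_of_exponent_le hβ.le h2)
  refine ⟨B, fun k => ?_⟩
  have := hB k
  rwa [div_le_iff₀ (hPpos k)] at this

/-- Since `d / f ≤ 1` and `σ ≤ 1`, one has `d / f ≤ (d / f) ^ σ = (b / f) ^ σ * (d / b) ^ σ`, which
covers all digit differences at once. -/
theorem le_mul_rpow_of_le_div {T D d f b P B σ : ℝ} (hσ0 : 0 < σ) (hσ1 : σ ≤ 1) (hd : 0 < d)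
    (hdf : d ≤ f) (hb : 0 < b) (hP : 0 < P) (hB : (b / f) ^ σ ≤ B * P) (hT : T ≤ 2 * d / (P * f))
    (hD : d / b ≤ D) : T ≤ 2 * B * D ^ σ := by
  have hf : 0 < f := hd.trans_le hdf
  have hB0 : 0 < B := by
    have : 0 < B * P := lt_of_lt_of_le (by positivity) hB
    exact pos_of_mul_pos_left this hP.le
  refine hT.trans ?_
  have h1 : (d / b) ^ σ ≤ D ^ σ := Real.rpow_le_rpow (by positivity) hD hσ0.le
  refine le_trans ?_ (mul_le_mul_of_nonneg_left h1 (by positivity))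
  have h2 : (d / f) ≤ (d / f) ^ σ := by
    have := Real.rpow_le_rpow_of_exponent_ge (div_pos hd hf) ((div_le_one hf).2 hdf) hσ1
    rwa [Real.rpow_one] at this
  have h3 : (d / f) ^ σ = (b / f) ^ σ * (d / b) ^ σ := by
    rw [← Real.mul_rpow (by positivity) (by positivity)]
    congr 1
    field_simp
  have h4 : d / f ≤ B * P * (d / b) ^ σ := by
    rw [h3] at h2
    exact h2.trans (mul_le_mul_of_nonneg_right hB (by positivity))
  have e : 2 * d / (P * f) = 2 * (d / f) / P := by field_simp
  rw [e, div_le_iff₀ hP]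
  linarith

/-- For `n k ≤ N < n (k + 1)` the time `n k` serves, at the cost of an exponent `r < s`. -/
theorem le_uniformRecExp_of_nearReturn {β s x : ℝ} (hβ : 1 < β) {n m : ℕ → ℕ}
    (hn0 : ∀ k, 1 ≤ n k) (hntop : Tendsto n atTop atTop) (hm : ∀ k, s * n (k + 1) ≤ m k)
    (hx : ∀ k, |(betaMap β)^[n k] x - x| ≤ (β ^ m k)⁻¹) :
    ENNReal.ofReal s ≤ uniformRecExp β x := by
  refine le_of_forall_lt fun a ha => ?_
  obtain ⟨r, hr1, hr2⟩ := ENNReal.lt_iff_exists_nnreal_btwn.1 ha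
  refine hr1.trans_le ?_
  have hrs : (r : ℝ) < s := by
    rw [← ENNReal.ofReal_coe_nnreal] at hr2
    exact (ENNReal.ofReal_lt_ofReal_iff_of_nonneg r.coe_nonneg).1 hr2
  refine le_sSup ⟨r, ⟨r.coe_nonneg, ?_⟩, ENNReal.ofReal_coe_nnreal⟩
  filter_upwards [eventually_ge_atTop (n 0)] with N hN
  classical
  have hex : ∃ k, N < n k := (hntop.eventually_gt_atTop N).exists
  obtain ⟨k, hk⟩ : ∃ k, Nat.find hex = k + 1 := by
    refine Nat.exists_eq_succ_of_ne_zero fun h0 => ?_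
    have := Nat.find_spec hex
    rw [h0] at this
    omega
  have h1 : N < n (k + 1) := hk ▸ Nat.find_spec hex
  have h2 : n k ≤ N := not_lt.1 (Nat.find_min hex (by omega))
  refine ⟨n k, hn0 k, h2, (hx k).trans_lt ?_⟩
  rw [pow_rpow_neg hβ, ← Real.rpow_natCast, ← Real.rpow_neg (by linarith)]
  refine Real.rpow_lt_rpow_of_exponent_lt hβ (neg_lt_neg ?_)
  have h3 : (N : ℝ) < n (k + 1) := by exact_mod_cast h1
  have h4 : (0 : ℝ) ≤ r := r.coe_nonneg
  have h5 : (r : ℝ) * N ≤ r * n (k + 1) := mul_le_mul_of_nonneg_left h3.le h4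
  have h6 : (r : ℝ) * n (k + 1) < s * n (k + 1) :=
    mul_lt_mul_of_pos_right hrs (lt_of_le_of_lt (Nat.cast_nonneg _) h3)
  linarith [hm k]

/-- Sequences of near-return times `n k`, with digits copied after each of them, in the proportions
that maximize the dimension. -/
theorem exists_nearReturn_parameters {β s : ℝ} (hβ : 1 < β) (hs : 0 < s) (hs1 : s < 1) :
    ∃ n m j ℓ : ℕ → ℕ, (∀ k, 1 ≤ n k) ∧ (∀ k, n (k + 1) = n k + j k + ℓ k) ∧
      (∀ k, 2 * (j k : ℝ) + 1 < β ^ j k * (β ^ m k)⁻¹) ∧ (∀ k, 2 ≤ halfFullCount β (ℓ k)) ∧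
      (∀ k, s * n (k + 1) ≤ m k) ∧ Tendsto n atTop atTop ∧
      Tendsto (fun k => (n (k + 1) : ℝ) / n k) atTop (𝓝 (2 / (1 - s))) ∧
      Tendsto (fun k => (ℓ k : ℝ) / n k) atTop (𝓝 1) := by
  set ρ := 2 / (1 - s) with hρ
  have hs1' : 0 < 1 - s := by linarith
  have hρ1 : 1 < ρ := by rw [hρ, lt_div_iff₀ hs1']; linarith
  have hρ0 : 0 < ρ := by linarith
  have hρs : (1 - s) * ρ = 2 := by rw [hρ]; field_simp
  set n : ℕ → ℕ := fun k => ⌊ρ ^ k⌋₊ with hn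
  set m : ℕ → ℕ := fun k => ⌈s * (n (k + 1) : ℝ)⌉₊ with hm
  -- The `k ^ 2` extra digits make `β ^ (k ^ 2)` exceed the exponentially growing `2 * j k + 1`, yet
  -- are negligible against `n k`. Since `(1 - s) * ρ = 2`, about `n k` digits remain free.
  set j : ℕ → ℕ := fun k => m k + k ^ 2 with hj
  set ℓ : ℕ → ℕ := fun k => n (k + 1) - n k - j k with hℓ
  have hpow : Tendsto (fun k : ℕ => ρ ^ k) atTop atTop := tendsto_pow_atTop_atTop_of_one_lt hρ1
  have hn1 : ∀ k, 1 ≤ n k := fun k => Nat.le_floor (by exact_mod_cast one_le_pow₀ hρ1.le)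
  have hnpos : ∀ k, (0 : ℝ) < n k := fun k => by exact_mod_cast hn1 k
  have hntop : Tendsto n atTop atTop := tendsto_nat_floor_atTop.comp hpow
  have hnR : Tendsto (fun k => (n k : ℝ)) atTop atTop := tendsto_natCast_atTop_atTop.comp hntop
  have hnρ : Tendsto (fun k => (n k : ℝ) / ρ ^ k) atTop (𝓝 1) :=
    tendsto_nat_floor_div_atTop.comp hpow
  have hratio : Tendsto (fun k => (n (k + 1) : ℝ) / n k) atTop (𝓝 ρ) := by
    have h1 := ((hnρ.comp (tendsto_add_atTop_nat 1)).mul_const ρ).div hnρ one_ne_zero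
    rw [one_mul, div_one] at h1
    refine h1.congr fun k => ?_
    have := hnpos k
    simp only [Function.comp, Pi.div_apply]
    rw [pow_succ]
    field_simp
  have hmlim : Tendsto (fun k => (m k : ℝ) / n k) atTop (𝓝 (s * ρ)) := by
    have h1 : Tendsto (fun k => (m k : ℝ) / n (k + 1)) atTop (𝓝 s) :=
      (tendsto_nat_ceil_mul_div_atTop hs.le).comp (hnR.comp (tendsto_add_atTop_nat 1))
    refine (h1.mul hratio).congr fun k => ?_
    have := hnpos k
    have := hnpos (k + 1)
    field_simp
  have hsq : Tendsto (fun k : ℕ => (k : ℝ) ^ 2 / n k) atTop (𝓝 0) := by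
    have h1 := (tendsto_pow_const_div_const_pow_of_one_lt 2 hρ1).div hnρ one_ne_zero
    rw [zero_div] at h1
    refine h1.congr fun k => ?_
    have := hnpos k
    simp only [Pi.div_apply]
    field_simp
  have hjlim : Tendsto (fun k => (j k : ℝ) / n k) atTop (𝓝 (s * ρ)) := by
    have h1 := hmlim.add hsq
    rw [add_zero] at h1
    refine h1.congr fun k => ?_
    simp only [hj]
    push_cast
    ring
  have hdiff : Tendsto (fun k => (n (k + 1) : ℝ) / n k - 1 - (j k : ℝ) / n k) atTop (𝓝 1) := by
    have h1 := (hratio.sub_const 1).sub hjlim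
    have e : ρ - 1 - s * ρ = 1 := by linarith
    rwa [e] at h1
  have hle : ∀ᶠ k in atTop, n k + j k ≤ n (k + 1) := by
    filter_upwards [hdiff.eventually (eventually_gt_nhds one_pos)] with k hk
    have h0 := hnpos k
    have e : (n (k + 1) : ℝ) / n k - 1 - (j k : ℝ) / n k = (n (k + 1) - n k - j k) / n k := by
      field_simp
    rw [e] at hk
    have h1 := (div_pos_iff_of_pos_right h0).1 hk
    have h2 : ((n k + j k : ℕ) : ℝ) ≤ n (k + 1) := by push_cast; linarith
    exact_mod_cast h2
  have hℓlim : Tendsto (fun k => (ℓ k : ℝ) / n k) atTop (𝓝 1) := by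
    refine hdiff.congr' ?_
    filter_upwards [hle] with k hk
    have h0 := hnpos k
    have e : (ℓ k : ℝ) = n (k + 1) - n k - j k := by
      have : n (k + 1) = n k + j k + ℓ k := by simp only [hℓ]; omega
      rw [this]; push_cast; ring
    rw [e]; field_simp
  have hℓtop : Tendsto ℓ atTop atTop := by
    have h1 : Tendsto (fun k => (ℓ k : ℝ) / n k * n k) atTop atTop :=
      hℓlim.pos_mul_atTop one_pos hnR
    exact tendsto_natCast_atTop_iff.1 (h1.congr fun k => div_mul_cancel₀ _ (hnpos k).ne')
  have hfull : ∀ᶠ k in atTop, 2 ≤ halfFullCount β (ℓ k) := by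
    have h1 := hℓtop.eventually
      (eventually_rpow_le_halfFullCount hβ (τ := 1 / 2) (by norm_num) (by norm_num))
    have h2 : Tendsto (fun k => β ^ ((1 / 2 : ℝ) * ℓ k)) atTop atTop :=
      (tendsto_rpow_atTop_of_base_gt_one β hβ).comp
        ((tendsto_natCast_atTop_atTop.comp hℓtop).const_mul_atTop (by norm_num))
    filter_upwards [h1, h2.eventually_ge_atTop 2] with k h1 h2
    exact_mod_cast h2.trans h1
  have hjbig : ∀ᶠ k in atTop, 2 * (j k : ℝ) + 1 < β ^ j k * (β ^ m k)⁻¹ := by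
    have h1 : ∀ᶠ k : ℕ in atTop, 4 * ρ ^ 2 ≤ β ^ k :=
      (tendsto_pow_atTop_atTop_of_one_lt hβ).eventually_ge_atTop _
    filter_upwards [h1, hle, eventually_ge_atTop 1] with k h1 h2 hk
    have e : β ^ j k * (β ^ m k)⁻¹ = (β ^ k) ^ k := by
      have : β ^ m k ≠ 0 := by positivity
      simp only [hj]
      rw [pow_add, ← pow_mul, sq]; field_simp
    rw [e]
    have h3 : (j k : ℝ) ≤ ρ ^ (k + 1) := by
      have : (j k : ℝ) ≤ n (k + 1) := by exact_mod_cast (show j k ≤ n (k + 1) by omega)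
      exact this.trans (Nat.floor_le (by positivity))
    have h4 : (1 : ℝ) ≤ ρ ^ (k + 1) := one_le_pow₀ hρ1.le
    have h5 : ρ ^ (k + 1) ≤ (ρ ^ 2) ^ k := by
      rw [← pow_mul]; exact pow_le_pow_right₀ hρ1.le (by omega)
    have h6 : (4 : ℝ) ≤ 4 ^ k := by simpa using pow_le_pow_right₀ (show (1 : ℝ) ≤ 4 by norm_num) hk
    calc 2 * (j k : ℝ) + 1 < 4 * ρ ^ (k + 1) := by linarith
      _ ≤ 4 ^ k * (ρ ^ 2) ^ k := by gcongr
      _ = (4 * ρ ^ 2) ^ k := (mul_pow _ _ _).symm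
      _ ≤ _ := by gcongr
  -- All conditions hold from `K` on; shifting the sequences makes them hold everywhere.
  obtain ⟨K, hK⟩ := eventually_atTop.1 (hle.and (hfull.and hjbig))
  refine ⟨fun k => n (k + K), fun k => m (k + K), fun k => j (k + K), fun k => ℓ (k + K),
    fun k => hn1 _, fun k => ?_, fun k => (hK (k + K) (by omega)).2.2,
    fun k => (hK (k + K) (by omega)).2.1, fun k => ?_, hntop.comp (tendsto_add_atTop_nat K), ?_,
    hℓlim.comp (tendsto_add_atTop_nat K)⟩
  · have := (hK (k + K) (by omega)).1
    have e : k + 1 + K = k + K + 1 := by omega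
    simp only [e, hℓ]
    omega
  · have e : k + 1 + K = k + K + 1 := by omega
    simp only [e, hm]
    exact Nat.le_ceil _
  · refine (hratio.comp (tendsto_add_atTop_nat K)).congr fun k => ?_
    have e : k + 1 + K = k + K + 1 := by omega
    simp only [Function.comp, e]

theorem exists_param_uniformRecExp {β s : ℝ} (hβ : 1 < β) (hs : 0 < s) (hs1 : s < 1) :
    ∃ x : ℝ → ℝ, (∀ t, x t ∈ Set.Ico (0 : ℝ) 1 ∧ ENNReal.ofReal s ≤ uniformRecExp β (x t)) ∧
      ∀ σ, 0 < σ → σ < ((1 - s) / (1 + s)) ^ 2 → ∃ B, ∀ t ∈ Set.Ico (0 : ℝ) 1,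
        ∀ t' ∈ Set.Ico (0 : ℝ) 1, |t - t'| ≤ B * |x t - x t'| ^ σ := by
  obtain ⟨n, m, j, ℓ, hn0, hn, hj, hf, hm, hntop, hratio, hℓ⟩ :=
    exists_nearReturn_parameters hβ hs hs1
  obtain ⟨x, hx, hsep⟩ := exists_param_nearReturn hβ hn0 hn hj hf
  refine ⟨x, fun t => ⟨(hx t 0).1,
    le_uniformRecExp_of_nearReturn hβ hn0 hntop hm fun k => (hx t k).2⟩, fun σ hσ0 hσ => ?_⟩
  have hs1' : 0 < 1 - s := by linarith
  have hρ1 : 1 < 2 / (1 - s) := by rw [lt_div_iff₀ hs1']; linarith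
  have e : 2 / (1 - s) - 1 = (1 + s) / (1 - s) := by field_simp; ring
  have hσρ : σ * (2 / (1 - s) - 1) ^ 2 < 1 := by
    rw [e]
    rw [div_pow, lt_div_iff₀ (by positivity)] at hσ
    rw [div_pow, ← mul_div_assoc, div_lt_one (by positivity)]
    exact hσ
  have hσ1 : σ ≤ 1 := by
    refine hσ.le.trans (pow_le_one₀ (by positivity) ?_)
    rw [div_le_one (by linarith)]; linarith
  obtain ⟨B, hB⟩ := exists_rpow_le_mul_prod_halfFullCount hβ hρ1 hσ0 hσρ hntop hratio hℓ hf
  refine ⟨2 * B, fun t ht t' ht' => ?_⟩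
  by_cases hne : t = t'
  · simp [hne, Real.zero_rpow hσ0.ne']
  obtain ⟨k, d, hd0, hdf, h1, h2⟩ := hsep t ht t' ht' hne
  rw [Finset.prod_range_succ] at h1
  have hfpos : ∀ k, (0 : ℝ) < halfFullCount β (ℓ k) := fun k => by
    have := hf k; exact_mod_cast (show 0 < halfFullCount β (ℓ k) by omega)
  exact le_mul_rpow_of_le_div hσ0 hσ1 hd0 hdf (by positivity)
    (Finset.prod_pos fun i _ => hfpos i) (hB k) h1 h2

/-! ### Lower bounds from Hölder inverses and conclusion -/

theorem dimH_le_div_of_inverse_holder {x : ℝ → ℝ} {σ B : ℝ} (hσ : 0 < σ) {A : Set ℝ}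
    (hB : ∀ t ∈ A, ∀ t' ∈ A, |t - t'| ≤ B * |x t - x t'| ^ σ) :
    dimH A ≤ dimH (x '' A) / ENNReal.ofReal σ := by
  set g := Function.invFunOn x A with hg
  have hinj : Set.InjOn x A := by
    intro t ht t' ht' h
    have := hB t ht t' ht'
    rw [h, sub_self, abs_zero, Real.zero_rpow hσ.ne', mul_zero] at this
    exact sub_eq_zero.1 (abs_eq_zero.1 (le_antisymm this (abs_nonneg _)))
  have hgx : ∀ t ∈ A, g (x t) = t := fun t ht => hinj.leftInvOn_invFunOn ht
  have hhol : HolderOnWith B.toNNReal σ.toNNReal g (x '' A) := by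
    rintro _ ⟨t, ht, rfl⟩ _ ⟨t', ht', rfl⟩
    rw [hgx t ht, hgx t' ht', edist_dist, edist_dist, Real.dist_eq, Real.dist_eq,
      Real.coe_toNNReal _ hσ.le, ENNReal.ofReal_rpow_of_nonneg (abs_nonneg _) hσ.le]
    change _ ≤ ENNReal.ofReal B * _
    rcases le_total 0 B with h0 | h0
    · rw [← ENNReal.ofReal_mul h0]
      exact ENNReal.ofReal_le_ofReal (hB t ht t' ht')
    · have h1 : |t - t'| ≤ 0 := (hB t ht t' ht').trans
        (mul_nonpos_of_nonpos_of_nonneg h0 (by positivity))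
      rw [ENNReal.ofReal_of_nonpos h1]
      exact zero_le
  have h1 := hhol.dimH_image_le (Real.toNNReal_pos.2 hσ)
  have h2 : A ⊆ g '' (x '' A) := fun t ht => ⟨x t, ⟨t, ht, rfl⟩, hgx t ht⟩
  exact (dimH_mono h2).trans h1

theorem volume_eq_zero_of_dimH_lt_one {A : Set ℝ} (h : dimH A < 1) : volume A = 0 := by
  have := hausdorffMeasure_of_dimH_lt (d := 1) (s := A) (by simpa using h)
  rw [← hausdorffMeasure_real]
  simpa using this

/-- If `[0, 1)` is parametrized onto a set by a map with nearly `d`-Hölder inverse, then removing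
countably many sets of dimension less than `d` leaves a set of dimension at least `d`. -/
theorem le_dimH_of_inverse_holder {x : ℝ → ℝ} {d : ℝ} {G : Set ℝ} {bad : ℕ → Set ℝ}
    (hx : ∀ σ, 0 < σ → σ < d → ∃ B, ∀ t ∈ Set.Ico (0 : ℝ) 1, ∀ t' ∈ Set.Ico (0 : ℝ) 1,
      |t - t'| ≤ B * |x t - x t'| ^ σ)
    (hbad : ∀ i, dimH (bad i) < ENNReal.ofReal d)
    (hcov : ∀ t ∈ Set.Ico (0 : ℝ) 1, x t ∈ G ∨ ∃ i, x t ∈ bad i) :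
    ENNReal.ofReal d ≤ dimH G := by
  have hdim : ∀ A ⊆ Set.Ico (0 : ℝ) 1, ∀ H : Set ℝ, x '' A ⊆ H → ∀ σ, 0 < σ → σ < d →
      dimH A ≤ dimH H / ENNReal.ofReal σ := by
    intro A hA H hH σ hσ0 hσ
    obtain ⟨B, hB⟩ := hx σ hσ0 hσ
    refine (dimH_le_div_of_inverse_holder hσ0 fun t ht t' ht' => hB t (hA ht) t' (hA ht')).trans ?_
    exact ENNReal.div_le_div_right (dimH_mono hH) _
  -- With `σ` strictly between `dimH (bad i)` and `d`, the parameters of bad points have dimension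
  -- less than 1.
  have hnull : ∀ i, volume {t | t ∈ Set.Ico (0 : ℝ) 1 ∧ x t ∈ bad i} = 0 := by
    intro i
    obtain ⟨σ, hσ1, hσ2⟩ := ENNReal.lt_iff_exists_nnreal_btwn.1 (hbad i)
    have hσ0 : (0 : ℝ) < σ := by exact_mod_cast (zero_le (a := dimH (bad i))).trans_lt hσ1
    rw [← ENNReal.ofReal_coe_nnreal] at hσ2
    have hσd := (ENNReal.ofReal_lt_ofReal_iff_of_nonneg σ.coe_nonneg).1 hσ2
    refine volume_eq_zero_of_dimH_lt_one ?_
    refine (hdim _ (fun t ht => ht.1) (bad i) ?_ σ hσ0 hσd).trans_lt ?_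
    · rintro _ ⟨t, ht, rfl⟩
      exact ht.2
    · rw [ENNReal.ofReal_coe_nnreal]
      refine (ENNReal.div_lt_iff (Or.inl ?_) (Or.inl ENNReal.coe_ne_top)).2 ?_
      · exact_mod_cast hσ0.ne'
      · rwa [one_mul]
  set A := {t | t ∈ Set.Ico (0 : ℝ) 1 ∧ x t ∈ G} with hA
  have hA1 : 1 ≤ dimH A := by
    by_contra! hlt
    have h0 := volume_eq_zero_of_dimH_lt_one hlt
    have hsub : Set.Ico (0 : ℝ) 1 ⊆ A ∪ ⋃ i, {t | t ∈ Set.Ico (0 : ℝ) 1 ∧ x t ∈ bad i} := by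
      intro t ht
      rcases hcov t ht with h | ⟨i, hi⟩
      · exact Or.inl ⟨ht, h⟩
      · exact Or.inr (Set.mem_iUnion.2 ⟨i, ht, hi⟩)
    have h1 := measure_mono_null hsub (measure_union_null h0 (measure_iUnion_null hnull))
    rw [Real.volume_Ico] at h1
    norm_num at h1
  refine le_of_forall_lt fun a ha => ?_
  obtain ⟨σ, hσ1, hσ2⟩ := ENNReal.lt_iff_exists_nnreal_btwn.1 ha
  refine hσ1.trans_le ?_
  have hσ0 : (0 : ℝ) < σ := by exact_mod_cast (zero_le (a := a)).trans_lt hσ1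
  rw [← ENNReal.ofReal_coe_nnreal] at hσ2
  have hσd := (ENNReal.ofReal_lt_ofReal_iff_of_nonneg σ.coe_nonneg).1 hσ2
  have h2 := hA1.trans (hdim A (fun t ht => ht.1) G (by
    rintro _ ⟨t, ht, rfl⟩
    exact ht.2) σ hσ0 hσd)
  rw [ENNReal.ofReal_coe_nnreal, ENNReal.le_div_iff_mul_le (Or.inl (by exact_mod_cast hσ0.ne'))
    (Or.inl ENNReal.coe_ne_top), one_mul] at h2
  exact h2

theorem le_dimH_uniformRecExp_eq {β s : ℝ} (hβ : 1 < β) (hs : 0 ≤ s) (hs1 : s < 1) :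
    ENNReal.ofReal (((1 - s) / (1 + s)) ^ 2) ≤
      dimH {x : ℝ | x ∈ Set.Ico (0 : ℝ) 1 ∧ uniformRecExp β x = ENNReal.ofReal s} := by
  obtain ⟨x, hx, hholder⟩ : ∃ x : ℝ → ℝ,
      (∀ t ∈ Set.Ico (0 : ℝ) 1,
        x t ∈ Set.Ico (0 : ℝ) 1 ∧ ENNReal.ofReal s ≤ uniformRecExp β (x t)) ∧
      ∀ σ, 0 < σ → σ < ((1 - s) / (1 + s)) ^ 2 → ∃ B, ∀ t ∈ Set.Ico (0 : ℝ) 1,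
        ∀ t' ∈ Set.Ico (0 : ℝ) 1, |t - t'| ≤ B * |x t - x t'| ^ σ := by
    rcases hs.eq_or_lt with rfl | hs0
    -- For `s = 0` no near-return is required and the identity serves, with `d = 1`.
    · refine ⟨id, fun t ht => ⟨ht, by simp⟩, fun σ hσ0 hσ => ⟨1, fun t ht t' ht' => ?_⟩⟩
      have hσ1 : σ ≤ 1 := by norm_num at hσ; exact hσ.le
      rw [one_mul, id, id]
      have h1 : |t - t'| ≤ 1 := abs_le.2 ⟨by linarith [ht.1, ht'.2], by linarith [ht.2, ht'.1]⟩
      rcases (abs_nonneg (t - t')).eq_or_lt with h0 | h0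
      · rw [← h0, Real.zero_rpow hσ0.ne']
      · simpa using Real.rpow_le_rpow_of_exponent_ge h0 h1 hσ1
    · obtain ⟨x, h1, h2⟩ := exists_param_uniformRecExp hβ hs0 hs1
      exact ⟨x, fun t _ => h1 t, h2⟩
  have hs1' : 0 < 1 - s := by linarith
  -- Values in `(s, 1]` decreasing to `s`; beyond 1 the squared ratio would increase again.
  set S : ℕ → ℝ := fun i => s + (1 - s) * (1 / ((i : ℝ) + 1)) with hS
  have hSlim : Tendsto S atTop (𝓝 s) := by
    have := (tendsto_one_div_add_atTop_nhds_zero_nat (𝕜 := ℝ)).const_mul (1 - s)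
    have := this.const_add s
    rwa [mul_zero, add_zero] at this
  refine le_dimH_of_inverse_holder (x := x) (bad := fun i =>
    {x : ℝ | x ∈ Set.Ico (0 : ℝ) 1 ∧ ENNReal.ofReal (S i) ≤ uniformRecExp β x}) hholder ?_ ?_
  · intro i
    have hpos : 0 < 1 / ((i : ℝ) + 1) := by positivity
    have hle : 1 / ((i : ℝ) + 1) ≤ 1 := by
      rw [div_le_one (by positivity)]
      have : (0 : ℝ) ≤ i := Nat.cast_nonneg _
      linarith
    have hSs : s < S i := by
      have := mul_pos hs1' hpos
      simp only [hS]; linarith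
    have hS1 : S i ≤ 1 := by
      have := mul_le_of_le_one_right hs1'.le hle
      simp only [hS]; linarith
    refine (dimH_le_uniformRecExp_le hβ (hs.trans_lt hSs)).trans_lt ?_
    refine (ENNReal.ofReal_lt_ofReal_iff (by positivity)).2 ?_
    have h0 : 0 ≤ (1 - S i) / (1 + S i) := div_nonneg (by linarith) (by linarith)
    refine pow_lt_pow_left₀ ?_ h0 two_ne_zero
    rw [div_lt_div_iff₀ (by linarith) (by linarith)]
    linarith
  · intro t ht
    obtain ⟨h1, h2⟩ := hx t ht
    rcases h2.eq_or_lt with h | h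
    · exact Or.inl ⟨h1, h.symm⟩
    · have h3 := (ENNReal.tendsto_ofReal hSlim).eventually (eventually_lt_nhds h)
      obtain ⟨i, hi⟩ := h3.exists
      exact Or.inr ⟨i, h1, hi.le⟩

theorem theorem3 (β : ℝ) (hβ : 1 < β) :
    dimH {x : ℝ | x ∈ Set.Ico (0 : ℝ) 1 ∧ ratioOneAdd (recExp β x) < uniformRecExp β x} = 0 ∧
    ∀ s : ℝ, 0 ≤ s → s ≤ 1 →
      dimH {x : ℝ | x ∈ Set.Ico (0 : ℝ) 1 ∧ ENNReal.ofReal s ≤ uniformRecExp β x}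
        = ENNReal.ofReal (((1 - s) / (1 + s)) ^ 2) ∧
      dimH {x : ℝ | x ∈ Set.Ico (0 : ℝ) 1 ∧ uniformRecExp β x = ENNReal.ofReal s}
        = ENNReal.ofReal (((1 - s) / (1 + s)) ^ 2) := by
  refine ⟨dimH_ratioOneAdd_recExp_lt_uniformRecExp hβ, fun s hs hs1 => ?_⟩
  have hsub : {x : ℝ | x ∈ Set.Ico (0 : ℝ) 1 ∧ uniformRecExp β x = ENNReal.ofReal s} ⊆
      {x : ℝ | x ∈ Set.Ico (0 : ℝ) 1 ∧ ENNReal.ofReal s ≤ uniformRecExp β x} :=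
    fun x hx => ⟨hx.1, hx.2.ge⟩
  have hupper : dimH {x : ℝ | x ∈ Set.Ico (0 : ℝ) 1 ∧ ENNReal.ofReal s ≤ uniformRecExp β x} ≤
      ENNReal.ofReal (((1 - s) / (1 + s)) ^ 2) := by
    -- The covering bound needs a positive exponent; at 0 the claim is the dimension of the line.
    rcases hs.eq_or_lt with rfl | hs0
    · refine (dimH_mono (Set.subset_univ _)).trans ?_
      rw [Real.dimH_univ]; simp
    · exact dimH_le_uniformRecExp_le hβ hs0
  have hlower : ENNReal.ofReal (((1 - s) / (1 + s)) ^ 2) ≤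
      dimH {x : ℝ | x ∈ Set.Ico (0 : ℝ) 1 ∧ uniformRecExp β x = ENNReal.ofReal s} := by
    rcases hs1.eq_or_lt with rfl | hs1
    · simp
    · exact le_dimH_uniformRecExp_eq hβ hs hs1
  exact ⟨le_antisymm hupper (hlower.trans (dimH_mono hsub)),
    le_antisymm ((dimH_mono hsub).trans hupper) hlower⟩
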